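/- **Theorem 3.1 (Magic formula for CMV matrices, even $p$).** For a sequence $\alpha=\{\alpha_n\}_{n\in\mathbb Z}$ in the open unit disk $\mathbb D$, put $\rho_n=(1-|\alpha_n|^2)^{1/2}$, $\Theta(\alpha_n)=\begin{pmatrix}\bar\alpha_n&\rho_n\\ \rho_n&-\alpha_n\end{pmatrix}$, and let $\mathcal C(\alpha)=\mathcal L\mathcal M$ be the two-sided (extended) CMV matrix with Verblunsky coefficients $\alpha$: the operator on $\ell^2(\mathbb Z)$ for which $\mathcal L=\bigoplus_{n\text{ even}}\Theta(\alpha_n)$ and $\mathcal M=\bigoplus_{n\text{ odd}}\Theta(\alpha_n)$, each block $\Theta(\alpha_n)$ acting on the coordinates $n,n+1$. Let $p\ge 2$ be even and let $\mathcal C_0=\mathcal C(\alpha^{(0)})$ with $\alpha^{(0)}$ a $p$-periodic sequence in $\mathbb D$. Its discriminant is the Laurent polynomial $$\Delta_{\mathcal C_0}(z)=\operatorname{Tr}\bigl(z^{-p/2}M_{p-1}(z)\cdots M_1(z)M_0(z)\bigr),\qquad M_n(z)=\frac1{\rho_n^{(0)}}\begin{pmatrix}z&-\overline{\alpha_n^{(0)}}\\-\alpha_n^{(0)}z&1\end{pmatrix},$$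 and its isospectral torus $\mathcal T_{\mathcal C_0}$ is the set of all $p$-periodic sequences $\beta$ in $\mathbb D$ such that $\mathcal C(\beta)$ and $\mathcal C_0$ have the same spectrum as operators on $\ell^2(\mathbb Z)$. Let $S$ be the right shift on $\ell^2(\mathbb Z)$, $(Su)_n=u_{n-1}$. Then for every two-sided sequence $\alpha$ in $\mathbb D$ (not a priori periodic), with $\mathcal C=\mathcal C(\alpha)$, $$\Delta_{\mathcal C_0}(\mathcal C)=S^p+S^{-p}\quad\Longleftrightarrow\quad \alpha\in\mathcal T_{\mathcal C_0}.$$ In particular, the identity $\Delta_{\mathcal C_0}(\mathcal C)=S^p+S^{-p}$ forces $\alpha_{n+p}=\alpha_n$ for all $n\in\mathbb Z$. -/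

import Mathlib

open scoped LaurentPolynomial ComplexConjugate Complex.UnitDisc

noncomputable section

namespace CMV

/-- The Hilbert space `ℓ²(ℤ)` of square summable two-sided complex sequences. -/
abbrev l2Z : Type := lp (fun _ : ℤ => ℂ) 2

/-! ### The right shift -/

theorem memlp_shift (k : ℤ) (u : l2Z) : Memℓp (fun n : ℤ => u (n - k)) 2 := by
  have h := (lp.memℓp u).summable (by norm_num)
  exact memℓp_gen ((Equiv.subRight k).summable_iff.mpr h)

theorem norm_shift_le (k : ℤ) (u : l2Z) :
    ‖(⟨fun n : ℤ => u (n - k), memlp_shift k u⟩ : l2Z)‖ ≤ 1 * ‖u‖ := by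
  have hp : (0 : ℝ) < (2 : ENNReal).toReal := by norm_num
  rw [one_mul]
  refine lp.norm_le_of_tsum_le hp (norm_nonneg _) ?_
  rw [lp.norm_rpow_eq_tsum hp u]
  exact ((Equiv.subRight k).tsum_eq (fun n : ℤ => ‖u n‖ ^ (2 : ENNReal).toReal)).le

/-- The translation `(u n) ↦ (u (n - k))` as a bounded operator on `ℓ²(ℤ)`. -/
def translation (k : ℤ) : l2Z →L[ℂ] l2Z :=
  LinearMap.mkContinuous
    { toFun := fun u => ⟨fun n : ℤ => u (n - k), memlp_shift k u⟩
      map_add' := fun _ _ => rfl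
      map_smul' := fun _ _ => rfl }
    1 (norm_shift_le k)

@[simp] theorem translation_apply (k : ℤ) (u : l2Z) (n : ℤ) :
    translation k u n = u (n - k) := rfl

/-- The right shift `(S u) n = u (n - 1)`, as an invertible bounded operator on `ℓ²(ℤ)`. -/
def shift : (l2Z →L[ℂ] l2Z)ˣ where
  val := translation 1
  inv := translation (-1)
  val_inv := by ext u n; simp
  inv_val := by ext u n; simp

/-! ### Extended CMV matrices -/

/-- `ρ = (1 - |α|²)^{1/2}`. -/
def rho (a : 𝔻) : ℝ := √(1 - ‖(a : ℂ)‖ ^ 2)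

/-- The `2 × 2` unitary block `Θ(α)`. -/
def Theta (a : 𝔻) : Matrix (Fin 2) (Fin 2) ℂ :=
  !![conj (a : ℂ), (rho a : ℂ); (rho a : ℂ), -(a : ℂ)]

/-- The action on sequences of the direct sum of the blocks `Θ(α_m)` over all integers `m` with
`m - e` even, the block `Θ(α_m)` acting on the coordinates `m, m + 1`. -/
def blockFun (e : ℤ) (α : ℤ → 𝔻) (u : ℤ → ℂ) (n : ℤ) : ℂ :=
  if Even (n - e) then Theta (α n) 0 0 * u n + Theta (α n) 0 1 * u (n + 1)
  else Theta (α (n - 1)) 1 0 * u (n - 1) + Theta (α (n - 1)) 1 1 * u n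

theorem rho_sq (a : 𝔻) : ((rho a : ℂ)) ^ 2 = 1 - conj (a : ℂ) * a := by
  have h : rho a ^ 2 = 1 - ‖(a : ℂ)‖ ^ 2 := Real.sq_sqrt (by linarith [a.sq_norm_lt_one])
  rw [← Complex.normSq_eq_conj_mul_self, Complex.normSq_eq_norm_sq]
  exact_mod_cast h

theorem norm_Theta_le (a : 𝔻) (i j : Fin 2) : ‖Theta a i j‖ ≤ 1 := by
  have h1 := a.norm_lt_one.le
  have h2 : |rho a| ≤ 1 := by
    rw [rho, abs_of_nonneg (Real.sqrt_nonneg _), Real.sqrt_le_one]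
    linarith [sq_nonneg ‖(a : ℂ)‖]
  fin_cases i <;> fin_cases j <;> simp [Theta, h1, h2]

theorem norm_blockFun_le (e : ℤ) (α : ℤ → 𝔻) (u : ℤ → ℂ) (n : ℤ) :
    ‖blockFun e α u n‖ ≤ ‖u n‖ + ‖u (n - -1)‖ + ‖u (n - 1)‖ := by
  have h (a : 𝔻) (i j : Fin 2) (x : ℂ) : ‖Theta a i j * x‖ ≤ ‖x‖ := by
    rw [norm_mul]; exact mul_le_of_le_one_left (norm_nonneg _) (norm_Theta_le a i j)
  rw [sub_neg_eq_add]
  unfold blockFun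
  split_ifs
  · have := norm_add_le (Theta (α n) 0 0 * u n) (Theta (α n) 0 1 * u (n + 1))
    linarith [h (α n) 0 0 (u n), h (α n) 0 1 (u (n + 1)), norm_nonneg (u (n - 1))]
  · have := norm_add_le (Theta (α (n - 1)) 1 0 * u (n - 1)) (Theta (α (n - 1)) 1 1 * u n)
    linarith [h (α (n - 1)) 1 0 (u (n - 1)), h (α (n - 1)) 1 1 (u n), norm_nonneg (u (n + 1))]

theorem memlp_blockFun (e : ℤ) (α : ℤ → 𝔻) (u : l2Z) : Memℓp (blockFun e α u) 2 :=
  (((lp.memℓp u).norm.add (memlp_shift (-1) u).norm).add (memlp_shift 1 u).norm).mono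
    (norm_blockFun_le e α u)

theorem norm_memlp_blockFun_le (e : ℤ) (α : ℤ → 𝔻) (u : l2Z) :
    ‖(⟨blockFun e α u, memlp_blockFun e α u⟩ : l2Z)‖ ≤ 3 * ‖u‖ := by
  have key (w : l2Z) :
      ‖(⟨fun n => ‖w n‖, (lp.memℓp w).norm⟩ : lp (fun _ : ℤ => ℝ) 2)‖ ≤ ‖w‖ :=
    lp.norm_mono (by norm_num) (fun i => by simp)
  have h : ‖(⟨blockFun e α u, memlp_blockFun e α u⟩ : l2Z)‖ ≤
      ‖(⟨fun n => ‖u n‖, (lp.memℓp u).norm⟩ : lp (fun _ : ℤ => ℝ) 2) +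
        ⟨fun n => ‖translation (-1) u n‖, (lp.memℓp (translation (-1) u)).norm⟩ +
        ⟨fun n => ‖translation 1 u n‖, (lp.memℓp (translation 1 u)).norm⟩‖ := by
    refine lp.norm_mono (by norm_num) (fun n => ?_)
    exact (norm_blockFun_le e α u n).trans (Real.le_norm_self _)
  have h1 : ‖translation (-1) u‖ ≤ 1 * ‖u‖ := norm_shift_le (-1) u
  have h2 : ‖translation 1 u‖ ≤ 1 * ‖u‖ := norm_shift_le 1 u
  refine h.trans ((norm_add₃_le).trans ?_)
  linarith [key u, key (translation (-1) u), key (translation 1 u)]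

/-- The direct sum of blocks described in `blockFun`, as a bounded operator on `ℓ²(ℤ)`. -/
def blockCLM (e : ℤ) (α : ℤ → 𝔻) : l2Z →L[ℂ] l2Z :=
  LinearMap.mkContinuous
    { toFun := fun u => ⟨blockFun e α u, memlp_blockFun e α u⟩
      map_add' := fun u v => by
        ext n
        simp only [blockFun, lp.coeFn_add, Pi.add_apply]
        split_ifs <;> ring
      map_smul' := fun c u => by
        ext n
        simp only [blockFun, lp.coeFn_smul, Pi.smul_apply, smul_eq_mul, RingHom.id_apply]
        split_ifs <;> ring }
    3 (norm_memlp_blockFun_le e α)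

@[simp] theorem blockCLM_apply (e : ℤ) (α : ℤ → 𝔻) (u : l2Z) (n : ℤ) :
    blockCLM e α u n = blockFun e α u n := rfl

theorem blockCLM_mul_star (e : ℤ) (α : ℤ → 𝔻) :
    blockCLM e α * blockCLM e (fun n => star (α n)) = 1 := by
  have hrho (a : 𝔻) : rho (star a) = rho a := by simp [rho]
  ext u n
  simp only [mul_apply_eq_comp, blockCLM_apply, one_apply_eq_self]
  by_cases hn : Even (n - e)
  · have hn' : ¬ Even (n + 1 - e) := by
      rw [show n + 1 - e = (n - e) + 1 by ring, Int.even_add_one]; simpa using hn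
    simp [blockFun, hn, hn', Theta, hrho]
    linear_combination (u n) * rho_sq (α n)
  · have hn' : Even (n - 1 - e) := by
      rw [show n - 1 - e = (n - e) - 1 by ring, Int.even_sub_one]; exact hn
    simp [blockFun, hn, hn', Theta, hrho]
    linear_combination (u n) * rho_sq (α (n - 1))

/-- The direct sum of blocks as an invertible operator; its inverse is the direct sum of the
blocks `Θ(α)⁻¹ = Θ(conj α)`. -/
def blockUnit (e : ℤ) (α : ℤ → 𝔻) : (l2Z →L[ℂ] l2Z)ˣ where
  val := blockCLM e α
  inv := blockCLM e (fun n => star (α n))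
  val_inv := blockCLM_mul_star e α
  inv_val := by simpa using blockCLM_mul_star e (fun n => star (α n))

/-- `ℒ = ⋯ ⊕ Θ(α₋₂) ⊕ Θ(α₀) ⊕ Θ(α₂) ⊕ ⋯`, with `Θ(α₂ₖ)` acting on the coordinates
`2k, 2k + 1`. -/
def opL (α : ℤ → 𝔻) : (l2Z →L[ℂ] l2Z)ˣ := blockUnit 0 α

/-- `ℳ = ⋯ ⊕ Θ(α₋₁) ⊕ Θ(α₁) ⊕ ⋯`, with `Θ(α₂ₖ₊₁)` acting on the coordinates
`2k + 1, 2k + 2`. -/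
def opM (α : ℤ → 𝔻) : (l2Z →L[ℂ] l2Z)ˣ := blockUnit 1 α

/-- The two-sided (extended) CMV matrix `𝒞 = ℒ ℳ` with Verblunsky coefficients `α`, as an
invertible bounded operator on `ℓ²(ℤ)`. -/
def extendedCMV (α : ℤ → 𝔻) : (l2Z →L[ℂ] l2Z)ˣ := opL α * opM α

/-! ### Discriminant and isospectral torus -/

open LaurentPolynomial in
/-- The one-step transfer matrix `M(z) = ρ⁻¹ [[z, -conj α], [-α z, 1]]`, its entries being
Laurent polynomials in the variable `z`. -/
def stepMatrix (a : 𝔻) : Matrix (Fin 2) (Fin 2) ℂ[T;T⁻¹] :=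
  C ((rho a : ℂ)⁻¹) • !![T 1, -C (conj (a : ℂ)); -(C (a : ℂ) * T 1), 1]

/-- The product `M_{n-1}(z) ⋯ M_1(z) M_0(z)` of step matrices. -/
def stepProd (α : ℤ → 𝔻) : ℕ → Matrix (Fin 2) (Fin 2) ℂ[T;T⁻¹]
  | 0 => 1
  | n + 1 => stepMatrix (α n) * stepProd α n

/-- The discriminant `Δ(z) = Tr (z^{-p/2} M_{p-1}(z) ⋯ M_0(z))` of the `p`-periodic sequence `α`
(for even `p`), a Laurent polynomial. -/
def discriminant (p : ℕ) (α : ℤ → 𝔻) : ℂ[T;T⁻¹] :=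
  Matrix.trace ((LaurentPolynomial.T (-((p / 2 : ℕ) : ℤ)) : ℂ[T;T⁻¹]) • stepProd α p)

/-- The isospectral torus of the `p`-periodic sequence `α₀`: all `p`-periodic sequences of
Verblunsky coefficients whose extended CMV matrix has the same spectrum on `ℓ²(ℤ)` as that of
`α₀`. -/
def isospectralTorus (p : ℕ) (α₀ : ℤ → 𝔻) : Set (ℤ → 𝔻) :=
  {β | Function.Periodic β (p : ℤ) ∧
    spectrum ℂ (extendedCMV β : l2Z →L[ℂ] l2Z) = spectrum ℂ (extendedCMV α₀ : l2Z →L[ℂ] l2Z)}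

/-- The identity `Δ_{𝒞₀}(𝒞) = S^p + S^{-p}` of bounded operators on `ℓ²(ℤ)`, where `𝒞₀` and `𝒞`
are the extended CMV matrices of `α₀` and `α`. The Laurent polynomial `Σ c_k z^k` is evaluated at
the invertible operator `𝒞` as `Σ c_k 𝒞^k`. -/
def MagicFormula (p : ℕ) (α₀ α : ℤ → 𝔻) : Prop :=
  (discriminant p α₀).smeval (extendedCMV α) =
    ((shift ^ (p : ℤ) : (l2Z →L[ℂ] l2Z)ˣ) : l2Z →L[ℂ] l2Z) +
      ((shift ^ (-(p : ℤ)) : (l2Z →L[ℂ] l2Z)ˣ) : l2Z →L[ℂ] l2Z)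

end CMV

end

/-! Throughout, `U = S^p`. The argument works directly on `ℓ²(ℤ)`, without a direct integral
decomposition.

*Periodic sequences.* The pair of functionals `(u n, (ℳ u) n)` is propagated in `n` by `2 × 2`
matrices over `ℂ[𝒞, 𝒞⁻¹]` of determinant `-1`; over one (even) period they multiply up to a matrix
of determinant `1` whose trace is the discriminant. Since a shift by `p` is then multiplication by
this matrix, Cayley–Hamilton reads `U + U⁻¹ = Δ(𝒞)`, the magic formula of a periodic sequence for
its own discriminant (`magicFormula_self`).

*The magic formula forces periodicity.* As `𝒞` commutes with `Δ₀(𝒞) = U + U⁻¹` and has only four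
possibly nonzero entries in each row, the entries `α_{m+1} ρ_m` and `ρ_{m+1} ρ_m` (up to
conjugation) are `p`-periodic. Their squared moduli add up to `ρ_m²`, so first `ρ` and then `α` is
periodic (`MagicFormula.periodic`).

*The magic formula determines the spectrum.* It implies that `z ∈ σ(𝒞)` if and only if `Δ₀(z) = x
+ x⁻¹` with `|x| = 1` (`MagicFormula.mem_spectrum_iff`), a condition in which `𝒞` does not appear;
compare with `𝒞₀`, for which the magic formula is known.

*Isospectral periodic sequences satisfy the magic formula.* Let `A = Δ₀(𝒞)`. It is normal, and its
spectrum `Δ₀(σ(𝒞₀))` is bounded by `2`, so `‖A‖ ≤ 2`. Comparing leading coefficients, `A = r (U +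
U⁻¹) + D` with `r = ∏ ρ(α) / ∏ ρ(α₀)` and `D` of band width less than `p`. Applying `A` to long
sums of the orthonormal vectors `U^{2k} δ_j`, whose images overlap in a single site only, turns
the norm bound into `‖A δ_j‖² + 2 r² ≤ 4` (`norm_column_sq_add_le`). As `A δ_j` has two entries
`r`, this gives `r ≤ 1`; exchanging `α` and `α₀` gives `r = 1`, and then `A δ_j` has no other
nonzero entries. -/

namespace CMV

open LaurentPolynomial

/-! ### Evaluation of Laurent polynomials and spectral mapping -/

section Evaluation

variable {A : Type*} [Ring A] [Algebra ℂ A]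

/-- Evaluation of complex Laurent polynomials at a unit of a (possibly noncommutative) algebra,
as an algebra homomorphism. -/
noncomputable def evalAt (x : Aˣ) : ℂ[T;T⁻¹] →ₐ[ℂ] A :=
  AddMonoidAlgebra.lift ℂ A ℤ ((Units.coeHom A).comp (zpowersHom Aˣ x))

theorem evalAt_T (x : Aˣ) (n : ℤ) : evalAt x (T n) = (x ^ n : Aˣ) := by
  rw [evalAt, T, AddMonoidAlgebra.lift_single]
  simp

theorem evalAt_C (x : Aˣ) (c : ℂ) : evalAt x (C c) = algebraMap ℂ A c := by
  rw [C_eq_algebraMap, AlgHom.commutes]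

theorem smeval_eq_evalAt (x : Aˣ) (f : ℂ[T;T⁻¹]) : f.smeval x = evalAt x f := by
  induction f using LaurentPolynomial.induction_on' with
  | add p q hp hq => rw [smeval_add, hp, hq, map_add]
  | C_mul_T n a =>
    rw [smeval_C_mul_T_n, map_mul, evalAt_C, evalAt_T, Algebra.smul_def]

theorem evalAt_toLaurent (x : Aˣ) (q : Polynomial ℂ) :
    evalAt x (Polynomial.toLaurent q) = Polynomial.aeval (x : A) q := by
  induction q using Polynomial.induction_on' with
  | add p q hp hq => simp only [map_add, hp, hq]
  | monomial n a =>
    rw [← Polynomial.C_mul_X_pow_eq_monomial, Polynomial.toLaurent_C_mul_X_pow, map_mul, evalAt_C,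
      evalAt_T, zpow_natCast, Units.val_pow_eq_pow_val, map_mul, Polynomial.aeval_C, map_pow,
      Polynomial.aeval_X]

/-- A Laurent polynomial takes the value `f z` modulo `T - z`. -/
theorem exists_sub_eval_eq_mul (f : ℂ[T;T⁻¹]) (z : ℂˣ) :
    ∃ h : ℂ[T;T⁻¹], f - C (evalAt z f) = (T 1 - C (z : ℂ)) * h := by
  obtain ⟨n, q, hq⟩ := exists_T_pow (f - C (evalAt z f))
  have hroot : q.IsRoot (z : ℂ) := by
    have := congrArg (evalAt z) hq
    rw [evalAt_toLaurent, map_mul, map_sub, evalAt_C] at this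
    simpa using this
  obtain ⟨r, rfl⟩ := Polynomial.dvd_iff_isRoot.mpr hroot
  refine ⟨Polynomial.toLaurent r * T (-n), ?_⟩
  have h2 : f - C (evalAt z f) = (f - C (evalAt z f)) * T n * T (-n) := by
    rw [mul_T_assoc]; simp
  rw [h2, ← hq]
  simp [mul_assoc]

end Evaluation

/-- Spectral mapping theorem for Laurent polynomials of an invertible element. -/
theorem mem_spectrum_evalAt_iff {A : Type*} [NormedRing A] [NormedAlgebra ℂ A] [CompleteSpace A]
    [Nontrivial A] (x : Aˣ) (f : ℂ[T;T⁻¹]) (w : ℂ) :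
    w ∈ spectrum ℂ (evalAt x f) ↔
      ∃ z : ℂˣ, (z : ℂ) ∈ spectrum ℂ (x : A) ∧ evalAt z f = w := by
  constructor
  · intro hw
    obtain ⟨n, q, hq⟩ := exists_T_pow (f - C w)
    have hx := congrArg (evalAt x) hq
    rw [evalAt_toLaurent, map_mul, map_sub, evalAt_C, evalAt_T] at hx
    have h0 : (0 : ℂ) ∈ spectrum ℂ (Polynomial.aeval (x : A) q) := by
      rw [spectrum.zero_mem_iff, hx, Units.isUnit_mul_units, ← IsUnit.neg_iff, neg_sub]
      exact spectrum.mem_iff.mp hw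
    rw [spectrum.map_polynomial_aeval] at h0
    obtain ⟨z, hz, hqz⟩ := h0
    have hz0 : z ≠ 0 := by
      rintro rfl
      exact spectrum.zero_notMem ℂ x.isUnit hz
    refine ⟨Units.mk0 z hz0, hz, ?_⟩
    have hv := congrArg (evalAt (Units.mk0 z hz0)) hq
    rw [evalAt_toLaurent, map_mul, map_sub, evalAt_C, evalAt_T] at hv
    simp only [Units.val_mk0, Polynomial.coe_aeval_eq_eval] at hv
    rw [show Polynomial.eval z q = 0 from hqz] at hv
    simpa [sub_eq_zero, hz0] using hv.symm
  · rintro ⟨z, hz, rfl⟩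
    obtain ⟨h, hh⟩ := exists_sub_eval_eq_mul f z
    have hx := congrArg (evalAt x) hh
    rw [map_sub, map_mul, map_sub, evalAt_C, evalAt_C, evalAt_T, zpow_one] at hx
    have hc : Commute ((x : A) - algebraMap ℂ A z) (evalAt x h) := by
      have := congrArg (evalAt x) (mul_comm (T 1 - C (z : ℂ)) h)
      rw [map_mul, map_mul, map_sub, evalAt_C, evalAt_T, zpow_one] at this
      exact this
    intro hu
    apply hz
    have hu' : IsUnit ((x : A) - algebraMap ℂ A z) := by
      have : IsUnit (evalAt x f - algebraMap ℂ A (evalAt z f)) := by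
        rw [← IsUnit.neg_iff, neg_sub]; exact hu
      rw [hx] at this
      exact (hc.isUnit_mul_iff.mp this).1
    have := hu'.neg
    rwa [neg_sub] at this

/-! ### Transfer matrices and the magic formula for periodic coefficients -/

theorem rho_pos (a : 𝔻) : 0 < rho a := Real.sqrt_pos.mpr (by linarith [a.sq_norm_lt_one])

theorem rho_ne_zero (a : 𝔻) : (rho a : ℂ) ≠ 0 := by exact_mod_cast (rho_pos a).ne'

theorem blockFun_of_even {e : ℤ} (α : ℤ → 𝔻) (u : ℤ → ℂ) {n : ℤ} (h : Even (n - e)) :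
    blockFun e α u n = conj (α n : ℂ) * u n + rho (α n) * u (n + 1) := by
  simp [blockFun, h, Theta]

theorem blockFun_succ_of_even {e : ℤ} (α : ℤ → 𝔻) (u : ℤ → ℂ) {n : ℤ} (h : Even (n - e)) :
    blockFun e α u (n + 1) = rho (α n) * u n - α n * u (n + 1) := by
  have h' : ¬ Even (n + 1 - e) := by
    rw [show n + 1 - e = (n - e) + 1 by ring, Int.even_add_one]; simpa using h
  rw [blockFun, if_neg h']
  simp [Theta, sub_eq_add_neg]

/-- The `2 × 2` matrix propagating the pair `(u n, (ℳ u) n)` from `n` to `n + 1`, where the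
variable of the Laurent polynomials stands for the action of `𝒞 = ℒ ℳ`. -/
noncomputable def transfer (α : ℤ → 𝔻) (n : ℤ) : Matrix (Fin 2) (Fin 2) ℂ[T;T⁻¹] :=
  C ((rho (α n) : ℂ)⁻¹) •
    if Even n then !![-C (α n : ℂ), T (-1); T 1, -C (conj (α n : ℂ))]
    else !![-C (conj (α n : ℂ)), 1; 1, -C (α n : ℂ)]

/-- The product of the `k` consecutive transfer matrices starting at the site `n`. -/
noncomputable def transferProd (α : ℤ → 𝔻) (n : ℤ) : ℕ → Matrix (Fin 2) (Fin 2) ℂ[T;T⁻¹]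
  | 0 => 1
  | k + 1 => transfer α (n + k) * transferProd α n k

theorem transferProd_succ' (α : ℤ → 𝔻) (n : ℤ) (k : ℕ) :
    transferProd α n (k + 1) = transferProd α (n + 1) k * transfer α n := by
  induction k with
  | zero => simp [transferProd]
  | succ k ih =>
    rw [transferProd, ih, transferProd, Matrix.mul_assoc]
    congr 2
    push_cast; ring

theorem det_transfer (α : ℤ → 𝔻) (n : ℤ) : (transfer α n).det = -1 := by
  have h := congrArg (C (R := ℂ)) (rho_sq (α n))
  have h1 : C ((rho (α n) : ℂ)⁻¹) * C (rho (α n) : ℂ) = 1 := by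
    rw [← map_mul, inv_mul_cancel₀ (rho_ne_zero _), map_one]
  have hT : (T (-1) : ℂ[T;T⁻¹]) * T 1 = 1 := by rw [← T_add]; simp
  simp only [map_pow, map_sub, map_mul, map_one] at h
  rw [transfer, Matrix.det_smul, Fintype.card_fin]
  split_ifs <;> rw [Matrix.det_fin_two_of]
  · linear_combination (C ((rho (α n) : ℂ)⁻¹) ^ 2) * h + C ((rho (α n) : ℂ)⁻¹) ^ 2 * (-hT)
      - (C ((rho (α n) : ℂ)⁻¹) * C (rho (α n) : ℂ) + 1) * h1
  · linear_combination (C ((rho (α n) : ℂ)⁻¹) ^ 2) * h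
      - (C ((rho (α n) : ℂ)⁻¹) * C (rho (α n) : ℂ) + 1) * h1

theorem det_transferProd (α : ℤ → 𝔻) (n : ℤ) (k : ℕ) :
    (transferProd α n k).det = (-1) ^ k := by
  induction k with
  | zero => simp [transferProd]
  | succ k ih => rw [transferProd, Matrix.det_mul, ih, det_transfer, pow_succ, mul_comm]

/-- The factor `z^{-1}` per two sites accounts for the normalization `z^{-p/2}` in the
discriminant. -/
theorem transfer_mul_transfer (α : ℤ → 𝔻) {n : ℤ} (hn : Even n) :
    transfer α (n + 1) * transfer α n =
      (T (-1) : ℂ[T;T⁻¹]) • (stepMatrix (α (n + 1)) * stepMatrix (α n)) := by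
  have hT : (T (-1) : ℂ[T;T⁻¹]) * T 1 = 1 := by rw [← T_add]; simp
  have hn' : ¬ Even (n + 1) := by rw [Int.even_add_one]; simpa using hn
  simp only [transfer, stepMatrix, hn, hn', if_true, if_false]
  generalize C ((rho (α n) : ℂ)⁻¹) = r
  generalize C ((rho (α (n + 1)) : ℂ)⁻¹) = s
  generalize C (α n : ℂ) = a
  generalize C (α (n + 1) : ℂ) = b
  generalize C (conj (α n : ℂ)) = a'
  generalize C (conj (α (n + 1) : ℂ)) = b'
  generalize (T (-1) : ℂ[T;T⁻¹]) = y at *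
  generalize (T 1 : ℂ[T;T⁻¹]) = x at *
  ext1 i j
  fin_cases i <;> fin_cases j <;>
    simp only [Matrix.mul_apply, Fin.sum_univ_two, Matrix.smul_apply, smul_eq_mul, Fin.zero_eta,
      Fin.mk_one, Matrix.of_apply, Matrix.cons_val', Matrix.cons_val_zero, Matrix.cons_val_one,
      Matrix.cons_val_fin_one]
  · linear_combination (-(s * r * x) - s * r * a * b') * hT
  · linear_combination (s * r * a') * hT
  · linear_combination (s * r * b * x + s * r * a) * hT
  · linear_combination (-(s * r * b * a')) * hT

theorem transferProd_zero_two_mul (α : ℤ → 𝔻) (k : ℕ) :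
    transferProd α 0 (2 * k) = (T (-(k : ℤ)) : ℂ[T;T⁻¹]) • stepProd α (2 * k) := by
  induction k with
  | zero => simp [transferProd, stepProd]
  | succ k ih =>
    rw [show 2 * (k + 1) = 2 * k + 1 + 1 by ring]
    simp only [transferProd, stepProd, ih]
    rw [← Matrix.mul_assoc, zero_add, zero_add, Nat.cast_add (2 * k) 1, Nat.cast_one,
      transfer_mul_transfer α (by simp), Matrix.smul_mul, Matrix.mul_smul, smul_smul, ← T_add,
      Matrix.mul_assoc]
    congr 2
    push_cast; ring

section Periodic

variable {p : ℕ} {α : ℤ → 𝔻}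

theorem transfer_add_period (hp : Even p) (hα : Function.Periodic α (p : ℤ)) (n : ℤ) :
    transfer α (n + p) = transfer α n := by
  have : Even (n + p) ↔ Even n := by
    have : Even (p : ℤ) := by exact_mod_cast hp
    rw [Int.even_add]; tauto
  rw [transfer, transfer, hα n, if_congr this rfl rfl]

theorem transferProd_add_period (hp : Even p) (hα : Function.Periodic α (p : ℤ)) (n : ℤ) (k : ℕ) :
    transferProd α (n + p) k = transferProd α n k := by
  induction k with
  | zero => rfl
  | succ k ih =>
    rw [transferProd, transferProd, ih, show n + p + k = n + k + p by ring,
      transfer_add_period hp hα]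

theorem trace_transferProd_succ (hp : Even p) (hp0 : 0 < p) (hα : Function.Periodic α (p : ℤ))
    (n : ℤ) : (transferProd α (n + 1) p).trace = (transferProd α n p).trace := by
  obtain ⟨q, rfl⟩ := Nat.exists_eq_succ_of_ne_zero hp0.ne'
  rw [Nat.succ_eq_add_one, transferProd_succ' α n, transferProd,
    show n + 1 + (q : ℤ) = n + (q + 1 : ℕ) by push_cast; ring, transfer_add_period hp hα,
    Matrix.trace_mul_comm]

theorem trace_transferProd (hp : Even p) (hp0 : 0 < p) (hα : Function.Periodic α (p : ℤ))
    (n : ℤ) : (transferProd α n p).trace = discriminant p α := by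
  have h0 : (transferProd α 0 p).trace = discriminant p α := by
    obtain ⟨k, rfl⟩ := hp.two_dvd
    rw [transferProd_zero_two_mul, discriminant]
    simp
  induction n using Int.induction_on with
  | zero => exact h0
  | succ n ih => rw [trace_transferProd_succ hp hp0 hα, ih]
  | pred n ih =>
    rw [← ih, ← trace_transferProd_succ hp hp0 hα]
    congr 2; ring

end Periodic

/-- Cayley–Hamilton for `2 × 2` matrices. -/
theorem mul_self_fin_two {R : Type*} [CommRing R] (P : Matrix (Fin 2) (Fin 2) R) :
    P * P = P.trace • P - P.det • 1 := by
  ext i j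
  fin_cases i <;> fin_cases j <;>
    simp [Matrix.mul_apply, Fin.sum_univ_two, Matrix.trace_fin_two, Matrix.det_fin_two] <;> ring

theorem extendedCMV_apply (α : ℤ → 𝔻) (u : l2Z) :
    (extendedCMV α : l2Z →L[ℂ] l2Z) u = blockCLM 0 α (blockCLM 1 α u) := rfl

/-- The pairing `(a₀(𝒞) u) n + (ℳ a₁(𝒞) u) n` of a row `(a₀, a₁)` of Laurent polynomials with the
column of functionals `u ↦ u n` and `u ↦ (ℳ u) n`. Rows are used so that the propagation in `n`
becomes right multiplication of `a` by `transfer`, over a commutative ring of coefficients. -/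
noncomputable def sitePairing (α : ℤ → 𝔻) (u : l2Z) (n : ℤ) (a : Fin 2 → ℂ[T;T⁻¹]) : ℂ :=
  evalAt (extendedCMV α) (a 0) u n + blockCLM 1 α (evalAt (extendedCMV α) (a 1) u) n

theorem sitePairing_sub (α : ℤ → 𝔻) (u : l2Z) (n : ℤ) (a b : Fin 2 → ℂ[T;T⁻¹]) :
    sitePairing α u n (a - b) = sitePairing α u n a - sitePairing α u n b := by
  simp only [sitePairing, Pi.sub_apply, map_sub, sub_apply, lp.coeFn_sub]
  ring

theorem sitePairing_succ (α : ℤ → 𝔻) (u : l2Z) (n : ℤ) (a : Fin 2 → ℂ[T;T⁻¹]) :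
    sitePairing α u (n + 1) a = sitePairing α u n (Matrix.vecMul a (transfer α n)) := by
  have hr := rho_ne_zero (α n)
  have hs := rho_sq (α n)
  have hC (f : ℂ[T;T⁻¹]) (c : ℂ) :
      evalAt (extendedCMV α) (C c * f) u = c • evalAt (extendedCMV α) f u := by
    rw [map_mul, evalAt_C]; simp
  have hT (f : ℂ[T;T⁻¹]) : evalAt (extendedCMV α) (f * T 1) u =
      blockCLM 0 α (blockCLM 1 α (evalAt (extendedCMV α) f u)) := by
    rw [mul_comm, map_mul, evalAt_T, zpow_one, mul_apply_eq_comp, extendedCMV_apply]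
  by_cases hn : Even n
  · have h0 : Even (n - 0) := by simpa using hn
    have hrow : Matrix.vecMul a (transfer α n) =
        ![C ((rho (α n) : ℂ)⁻¹) * (a 1 * T 1) - C ((rho (α n) : ℂ)⁻¹) * (C (α n : ℂ) * a 0),
          C ((rho (α n) : ℂ)⁻¹) * (a 0 * T (-1)) -
            C ((rho (α n) : ℂ)⁻¹) * (C (conj (α n : ℂ)) * a 1)] := by
      ext1 i
      fin_cases i <;> simp [transfer, hn, Matrix.vecMul, dotProduct, -map_inv₀] <;> ring
    have hT' : a 0 = a 0 * T (-1) * T 1 := by rw [mul_T_assoc]; simp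
    rw [hrow]
    simp only [sitePairing, Matrix.cons_val_zero, Matrix.cons_val_one, map_sub, sub_apply, hC,
      map_smul, lp.coeFn_sub, lp.coeFn_smul, Pi.sub_apply, Pi.smul_apply, smul_eq_mul, hT]
    have hT2 : evalAt (extendedCMV α) (a 0) u =
        blockCLM 0 α (blockCLM 1 α (evalAt (extendedCMV α) (a 0 * T (-1)) u)) := by
      rw [← hT, ← hT']
    rw [hT2]
    simp only [blockCLM_apply 0, blockFun_of_even _ _ h0, blockFun_succ_of_even _ _ h0]
    field_simp
    linear_combination (blockCLM 1 α (evalAt (extendedCMV α) (a 0 * T (-1)) u) n) * hs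
  · have h1 : Even (n - 1) := by rw [Int.even_sub_one]; exact hn
    have hrow : Matrix.vecMul a (transfer α n) =
        ![C ((rho (α n) : ℂ)⁻¹) * a 1 - C ((rho (α n) : ℂ)⁻¹) * (C (conj (α n : ℂ)) * a 0),
          C ((rho (α n) : ℂ)⁻¹) * a 0 - C ((rho (α n) : ℂ)⁻¹) * (C (α n : ℂ) * a 1)] := by
      ext1 i
      fin_cases i <;> simp [transfer, hn, Matrix.vecMul, dotProduct, -map_inv₀] <;> ring
    rw [hrow]
    simp only [sitePairing, Matrix.cons_val_zero, Matrix.cons_val_one, map_sub, sub_apply, hC,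
      map_smul, lp.coeFn_sub, lp.coeFn_smul, Pi.sub_apply, Pi.smul_apply, smul_eq_mul,
      blockCLM_apply 1, blockFun_of_even _ _ h1, blockFun_succ_of_even _ _ h1]
    field_simp
    linear_combination (evalAt (extendedCMV α) (a 1) u n) * hs

theorem sitePairing_add_nat (α : ℤ → 𝔻) (u : l2Z) (n : ℤ) (k : ℕ) (a : Fin 2 → ℂ[T;T⁻¹]) :
    sitePairing α u (n + k) a = sitePairing α u n (Matrix.vecMul a (transferProd α n k)) := by
  induction k generalizing a with
  | zero => simp [transferProd]
  | succ k ih =>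
    rw [transferProd, ← Matrix.vecMul_vecMul, ← ih, ← sitePairing_succ]
    congr 1; push_cast; ring

theorem coe_shift_zpow (k : ℤ) : ((shift ^ k : (l2Z →L[ℂ] l2Z)ˣ) : l2Z →L[ℂ] l2Z) =
    translation k := by
  induction k using Int.induction_on with
  | zero => ext u n; simp
  | succ k ih =>
    rw [zpow_add_one, Units.val_mul, ih]
    ext u n
    change u (n - k - 1) = u (n - (k + 1))
    rw [sub_sub]
  | pred k ih =>
    rw [zpow_sub_one, Units.val_mul, ih]
    ext u n
    change u (n - -k - -1) = u (n - (-k - 1))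
    rw [show n - -(k : ℤ) - -1 = n - (-k - 1) by ring]

theorem magicFormula_iff (p : ℕ) (α₀ α : ℤ → 𝔻) : MagicFormula p α₀ α ↔
    ∀ (u : l2Z) (n : ℤ), evalAt (extendedCMV α) (discriminant p α₀) u n =
      u (n - p) + u (n + p) := by
  rw [MagicFormula, smeval_eq_evalAt, coe_shift_zpow, coe_shift_zpow]
  constructor
  · intro h u n
    rw [h]
    simp
  · intro h
    ext u n
    rw [h]
    simp

/-- A periodic sequence satisfies the magic formula for its own discriminant. The operators `S^p`
and `𝒞` commute, `S^p` acts on the rank-two `ℂ[𝒞, 𝒞⁻¹]`-module of site pairings by a matrix of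
determinant `1` and trace `Δ`, and the identity is Cayley–Hamilton for that matrix. -/
theorem magicFormula_self {p : ℕ} {α : ℤ → 𝔻} (hp : Even p) (hp0 : 0 < p)
    (hα : Function.Periodic α (p : ℤ)) : MagicFormula p α α := by
  rw [magicFormula_iff]
  intro u n
  obtain ⟨m, rfl⟩ : ∃ m : ℤ, n = m + p := ⟨n - p, by ring⟩
  have hrow (f : ℂ[T;T⁻¹]) (k : ℤ) :
      sitePairing α u k ![f, 0] = evalAt (extendedCMV α) f u k := by
    simp [sitePairing]
  -- With base site `n - p`, two periods correspond to the square of the matrix over one period.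
  have key : sitePairing α u (m + p + p) ![1, 0] =
      sitePairing α u (m + p) ![discriminant p α, 0] - sitePairing α u m ![1, 0] := by
    rw [sitePairing_add_nat, sitePairing_add_nat, sitePairing_add_nat α u m,
      transferProd_add_period hp hα, Matrix.vecMul_vecMul, mul_self_fin_two,
      trace_transferProd hp hp0 hα, det_transferProd, hp.neg_one_pow, one_smul, Matrix.vecMul_sub,
      Matrix.vecMul_one, sitePairing_sub, Matrix.vecMul_smul, ← Matrix.smul_vecMul]
    simp
  rw [hrow, hrow, hrow] at key
  rw [map_one] at key
  simp only [one_apply_eq_self] at key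
  rw [show m + p - p = m by ring]
  linear_combination -key

/-! ### Matrix entries and periodicity -/

/-- The standard basis vector `δ_m` of `ℓ²(ℤ)`. -/
noncomputable def basisVec (m : ℤ) : l2Z := lp.single 2 m (1 : ℂ)

theorem basisVec_apply (m n : ℤ) : basisVec m n = if n = m then 1 else 0 := by
  rw [basisVec, lp.single_apply, Pi.single_apply]

instance : Nontrivial l2Z :=
  ⟨basisVec 0, 0, fun h => by simpa [basisVec_apply] using congrArg (fun u : l2Z => u 0) h⟩

theorem extendedCMV_apply_even (α : ℤ → 𝔻) (u : l2Z) {n : ℤ} (hn : Even n) :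
    (extendedCMV α : l2Z →L[ℂ] l2Z) u n =
      conj (α n : ℂ) * (rho (α (n - 1)) * u (n - 1) - α (n - 1) * u n) +
        rho (α n) * (conj (α (n + 1) : ℂ) * u (n + 1) + rho (α (n + 1)) * u (n + 2)) := by
  have h0 : Even (n - 0) := by simpa using hn
  have h1 : Even (n + 1 - 1) := by simpa using hn
  have h2 : Even (n - 1 - 1) := by rw [show n - 1 - 1 = n - 2 by ring]; exact hn.sub even_two
  have h3 := blockFun_succ_of_even α u h2
  rw [sub_add_cancel] at h3
  rw [extendedCMV_apply, blockCLM_apply, blockFun_of_even _ _ h0, blockCLM_apply, blockCLM_apply,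
    blockFun_of_even _ _ h1, h3, show n + 1 + 1 = n + 2 by ring]

theorem extendedCMV_apply_succ_even (α : ℤ → 𝔻) (u : l2Z) {n : ℤ} (hn : Even n) :
    (extendedCMV α : l2Z →L[ℂ] l2Z) u (n + 1) =
      rho (α n) * (rho (α (n - 1)) * u (n - 1) - α (n - 1) * u n) -
        α n * (conj (α (n + 1) : ℂ) * u (n + 1) + rho (α (n + 1)) * u (n + 2)) := by
  have h0 : Even (n - 0) := by simpa using hn
  have h1 : Even (n + 1 - 1) := by simpa using hn
  have h2 : Even (n - 1 - 1) := by rw [show n - 1 - 1 = n - 2 by ring]; exact hn.sub even_two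
  have h3 := blockFun_succ_of_even α u h2
  rw [sub_add_cancel] at h3
  rw [extendedCMV_apply, blockCLM_apply, blockFun_succ_of_even _ _ h0, blockCLM_apply,
    blockCLM_apply, blockFun_of_even _ _ h1, h3, show n + 1 + 1 = n + 2 by ring]

/-- The entry `𝒞 n m` of the matrix of `𝒞` in the standard basis. -/
noncomputable def entry (α : ℤ → 𝔻) (n m : ℤ) : ℂ :=
  (extendedCMV α : l2Z →L[ℂ] l2Z) (basisVec m) n

theorem entry_even_pred (α : ℤ → 𝔻) {n : ℤ} (hn : Even n) :
    entry α n (n - 1) = conj (α n : ℂ) * rho (α (n - 1)) := by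
  rw [entry, extendedCMV_apply_even α _ hn]
  simp only [basisVec_apply, if_true, if_neg (show ¬ n = n - 1 by omega),
    if_neg (show ¬ n + 1 = n - 1 by omega), if_neg (show ¬ n + 2 = n - 1 by omega)]
  ring

theorem entry_even_succ (α : ℤ → 𝔻) {n : ℤ} (hn : Even n) :
    entry α n (n + 1) = rho (α n) * conj (α (n + 1) : ℂ) := by
  rw [entry, extendedCMV_apply_even α _ hn]
  simp only [basisVec_apply, if_true, if_neg (show ¬ n = n + 1 by omega),
    if_neg (show ¬ n - 1 = n + 1 by omega), if_neg (show ¬ n + 2 = n + 1 by omega)]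
  ring

theorem entry_even_add_two (α : ℤ → 𝔻) {n : ℤ} (hn : Even n) :
    entry α n (n + 2) = rho (α n) * rho (α (n + 1)) := by
  rw [entry, extendedCMV_apply_even α _ hn]
  simp only [basisVec_apply, if_true, if_neg (show ¬ n = n + 2 by omega),
    if_neg (show ¬ n - 1 = n + 2 by omega), if_neg (show ¬ n + 1 = n + 2 by omega)]
  ring

theorem entry_odd_sub_two (α : ℤ → 𝔻) {n : ℤ} (hn : Even n) :
    entry α (n + 1) (n - 1) = rho (α n) * rho (α (n - 1)) := by
  rw [entry, extendedCMV_apply_succ_even α _ hn]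
  simp only [basisVec_apply, if_true, if_neg (show ¬ n = n - 1 by omega),
    if_neg (show ¬ n + 1 = n - 1 by omega), if_neg (show ¬ n + 2 = n - 1 by omega)]
  ring

theorem entry_eq_zero (α : ℤ → 𝔻) {n m : ℤ} (hn : Even n) (hm : n + 2 < m) :
    entry α n m = 0 ∧ entry α (n + 1) m = 0 := by
  rw [entry, entry, extendedCMV_apply_even α _ hn, extendedCMV_apply_succ_even α _ hn]
  simp [basisVec_apply, show ¬ n = m by omega, show ¬ n - 1 = m by omega,
    show ¬ n + 1 = m by omega, show ¬ n + 2 = m by omega]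

section Periodicity

variable {p : ℕ} {α₀ α : ℤ → 𝔻}

/-- The matrix form of the commutation of `𝒞` with `S^p + S^{-p}`. -/
theorem MagicFormula.entry_add_entry (h : MagicFormula p α₀ α) (n m : ℤ) :
    entry α n m + entry α n (m + 2 * p) = entry α (n - p) (m + p) + entry α (n + p) (m + p) := by
  rw [magicFormula_iff] at h
  have hc : evalAt (extendedCMV α) (discriminant p α₀) * (extendedCMV α : l2Z →L[ℂ] l2Z) =
      (extendedCMV α : l2Z →L[ℂ] l2Z) * evalAt (extendedCMV α) (discriminant p α₀) := by
    have := congrArg (evalAt (extendedCMV α)) (mul_comm (discriminant p α₀) (T 1))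
    rwa [map_mul, map_mul, evalAt_T, zpow_one] at this
  have hb : evalAt (extendedCMV α) (discriminant p α₀) (basisVec (m + p)) =
      basisVec m + basisVec (m + 2 * p) := by
    ext k
    rw [h, lp.coeFn_add, Pi.add_apply]
    simp only [basisVec_apply]
    rw [add_comm, if_congr (show k + p = m + p ↔ k = m by omega) rfl rfl,
      if_congr (show k - p = m + p ↔ k = m + 2 * p by omega) rfl rfl]
  have := congrArg (fun X : l2Z →L[ℂ] l2Z => X (basisVec (m + p)) n) hc
  simp only [mul_apply_eq_comp, hb, map_add] at this
  rw [h, lp.coeFn_add, Pi.add_apply] at this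
  exact this.symm

/-- The two entries that could interfere with periodicity lie above the band of `𝒞`; for `p = 2`
this uses that the band consists of four columns in each pair of rows `n, n + 1` with `n` even. -/
theorem MagicFormula.entry_add_period (h : MagicFormula p α₀ α) (hp : Even p) (hp0 : 0 < p)
    {n m : ℤ} (hn : Even n) (hm : n - 2 < m) :
    entry α (n + p) (m + p) = entry α n m ∧ entry α (n + 1 + p) (m + p) = entry α (n + 1) m := by
  have hp2 : 2 ≤ p := by obtain ⟨k, rfl⟩ := hp; omega
  have hpe : Even (n - p) := hn.sub (by exact_mod_cast hp)
  have h1 := h.entry_add_entry n m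
  have h2 := h.entry_add_entry (n + 1) m
  obtain ⟨h3, h4⟩ := entry_eq_zero α hn (m := m + 2 * p) (by omega)
  obtain ⟨h5, h6⟩ := entry_eq_zero α hpe (m := m + p) (by omega)
  rw [h3, h5] at h1
  rw [h4, show n + 1 - (p : ℤ) = n - p + 1 by ring, h6] at h2
  constructor
  · simpa using h1.symm
  · simpa using h2.symm

/-- The magic formula forces periodicity: the products `α_{m+1} ρ_m` and `ρ_{m+1} ρ_m`, which are
entries of `𝒞`, are `p`-periodic, and the sum of their squared moduli is `ρ_m²`. -/
theorem MagicFormula.periodic (h : MagicFormula p α₀ α) (hp : Even p) (hp0 : 0 < p) :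
    Function.Periodic α (p : ℤ) := by
  have hpe : Even (p : ℤ) := by exact_mod_cast hp
  have h1 (m : ℤ) : conj (α (m + 1 + p) : ℂ) * rho (α (m + p)) = conj (α (m + 1) : ℂ) * rho (α m) ∧
      (rho (α (m + p)) * rho (α (m + 1 + p)) : ℂ) = rho (α m) * rho (α (m + 1)) := by
    by_cases hm : Even m
    · have e1 := (h.entry_add_period hp hp0 hm (m := m + 1) (by omega)).1
      have e2 := (h.entry_add_period hp hp0 hm (m := m + 2) (by omega)).1
      rw [show m + 1 + (p : ℤ) = m + p + 1 by ring, entry_even_succ α hm,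
        entry_even_succ α (hm.add hpe)] at e1
      rw [show m + 2 + (p : ℤ) = m + p + 2 by ring, entry_even_add_two α hm,
        entry_even_add_two α (hm.add hpe)] at e2
      rw [show m + 1 + (p : ℤ) = m + p + 1 by ring]
      exact ⟨by linear_combination e1, e2⟩
    · obtain ⟨n, rfl⟩ : ∃ n, m = n - 1 := ⟨m + 1, by ring⟩
      have hn : Even n := by
        rw [Int.even_sub_one] at hm; simpa using hm
      have e1 := (h.entry_add_period hp hp0 hn (m := n - 1) (by omega)).1
      have e2 := (h.entry_add_period hp hp0 hn (m := n - 1) (by omega)).2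
      rw [show n - 1 + (p : ℤ) = n + p - 1 by ring, entry_even_pred α hn,
        entry_even_pred α (hn.add hpe)] at e1
      rw [show n - 1 + (p : ℤ) = n + p - 1 by ring, show n + 1 + (p : ℤ) = n + p + 1 by ring,
        entry_odd_sub_two α hn, entry_odd_sub_two α (hn.add hpe)] at e2
      rw [show n - 1 + 1 + (p : ℤ) = n + p by ring, show n - 1 + 1 = n by ring,
        show n - 1 + (p : ℤ) = n + p - 1 by ring]
      exact ⟨e1, by linear_combination e2⟩
  have hsq (a b : 𝔻) : (rho b : ℂ) ^ 2 =
      (conj (a : ℂ) * rho b) * conj (conj (a : ℂ) * rho b) + (rho b * rho a) ^ 2 := by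
    rw [map_mul, Complex.conj_conj, Complex.conj_ofReal, mul_pow, rho_sq a]; ring
  have hrho (m : ℤ) : rho (α (m + p)) = rho (α m) := by
    have : (rho (α (m + p)) : ℂ) ^ 2 = (rho (α m) : ℂ) ^ 2 := by
      rw [hsq (α (m + 1 + p)) (α (m + p)), hsq (α (m + 1)) (α m), (h1 m).1, (h1 m).2]
    have h2 : rho (α (m + p)) ^ 2 = rho (α m) ^ 2 := by exact_mod_cast this
    exact (pow_left_inj₀ (rho_pos _).le (rho_pos _).le two_ne_zero).mp h2
  intro m
  have h2 := (h1 (m - 1)).1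
  rw [hrho, sub_add_cancel] at h2
  have h3 := mul_right_cancel₀ (rho_ne_zero _) h2
  exact Complex.UnitDisc.coe_injective (RingHom.injective _ h3)

end Periodicity

/-! ### Supports -/

/-- The sequence `u` vanishes outside the interval `[a, b]`. -/
def SupportedIn (a b : ℤ) (u : l2Z) : Prop := ∀ n, n < a ∨ b < n → u n = 0

theorem supportedIn_basisVec (m : ℤ) : SupportedIn m m (basisVec m) := by
  intro n hn
  rw [basisVec_apply, if_neg (by omega)]

theorem SupportedIn.blockCLM {a b : ℤ} {u : l2Z} (h : SupportedIn a b u) (e : ℤ) (α : ℤ → 𝔻) :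
    SupportedIn (a - 1) (b + 1) (blockCLM e α u) := by
  intro n hn
  rw [blockCLM_apply, blockFun, h n (by omega), h (n + 1) (by omega), h (n - 1) (by omega)]
  simp

theorem SupportedIn.extendedCMV {a b : ℤ} {u : l2Z} (h : SupportedIn a b u) (α : ℤ → 𝔻) :
    SupportedIn (a - 2) (b + 2) ((extendedCMV α : l2Z →L[ℂ] l2Z) u) := by
  have := (h.blockCLM 1 α).blockCLM 0 α
  rwa [show a - 1 - 1 = a - 2 by ring, show b + 1 + 1 = b + 2 by ring] at this

theorem SupportedIn.extendedCMV_inv {a b : ℤ} {u : l2Z} (h : SupportedIn a b u) (α : ℤ → 𝔻) :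
    SupportedIn (a - 2) (b + 2) (((CMV.extendedCMV α)⁻¹ : (l2Z →L[ℂ] l2Z)ˣ).val u) := by
  have := (h.blockCLM 0 (fun n => star (α n))).blockCLM 1 (fun n => star (α n))
  rwa [show a - 1 - 1 = a - 2 by ring, show b + 1 + 1 = b + 2 by ring] at this

theorem SupportedIn.extendedCMV_zpow {a b : ℤ} {u : l2Z} (h : SupportedIn a b u) (α : ℤ → 𝔻)
    (k : ℤ) : SupportedIn (a - 2 * |k|) (b + 2 * |k|)
      ((CMV.extendedCMV α ^ k : (l2Z →L[ℂ] l2Z)ˣ).val u) := by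
  have hpos (k : ℕ) : SupportedIn (a - 2 * k) (b + 2 * k)
      ((CMV.extendedCMV α ^ k : (l2Z →L[ℂ] l2Z)ˣ).val u) := by
    induction k with
    | zero => simpa using h
    | succ k ih =>
      rw [pow_succ', Units.val_mul, mul_apply_eq_comp]
      convert ih.extendedCMV α using 1 <;> push_cast <;> ring
  have hneg (k : ℕ) : SupportedIn (a - 2 * k) (b + 2 * k)
      ((((CMV.extendedCMV α)⁻¹) ^ k : (l2Z →L[ℂ] l2Z)ˣ).val u) := by
    induction k with
    | zero => simpa using h
    | succ k ih =>
      rw [pow_succ', Units.val_mul, mul_apply_eq_comp]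
      convert ih.extendedCMV_inv α using 1 <;> push_cast <;> ring
  obtain ⟨n, rfl | rfl⟩ := k.eq_nat_or_neg
  · simpa using hpos n
  · simpa using hneg n

theorem evalAt_apply_eq_sum (x : (l2Z →L[ℂ] l2Z)ˣ) (f : ℂ[T;T⁻¹]) (u : l2Z) (n : ℤ) :
    evalAt x f u n = ∑ k ∈ f.coeff.support, f.coeff k * (x ^ k : (l2Z →L[ℂ] l2Z)ˣ).val u n := by
  rw [← smeval_eq_evalAt, smeval, Finsupp.sum, sum_apply, lp.coeFn_sum, Finset.sum_apply]
  rfl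

theorem SupportedIn.evalAt {a b : ℤ} {u : l2Z} (h : SupportedIn a b u) (α : ℤ → 𝔻)
    {f : ℂ[T;T⁻¹]} {d : ℤ} (hf : ∀ k, d < |k| → f.coeff k = 0) :
    SupportedIn (a - 2 * d) (b + 2 * d) (evalAt (CMV.extendedCMV α) f u) := by
  intro n hn
  rw [evalAt_apply_eq_sum]
  refine Finset.sum_eq_zero fun k hk => ?_
  have hkd : |k| ≤ d := by
    by_contra hlt
    exact Finsupp.mem_support_iff.mp hk (hf k (not_le.mp hlt))
  rw [h.extendedCMV_zpow α k n (by omega), mul_zero]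

theorem exists_coeff_bound (f : ℂ[T;T⁻¹]) : ∃ d : ℤ, ∀ k, d < |k| → f.coeff k = 0 := by
  refine ⟨∑ k ∈ f.coeff.support, |k|, fun k hk => ?_⟩
  by_contra hne
  have := Finset.single_le_sum (f := fun k : ℤ => |k|) (fun i _ => abs_nonneg i)
    (Finsupp.mem_support_iff.mpr hne)
  exact absurd hk (not_lt.mpr this)

/-! ### The spectrum in terms of the discriminant -/

theorem eq_zero_of_tendsto_of_norm_succ {a : ℕ → ℂ} (h0 : Filter.Tendsto a Filter.atTop (nhds 0))
    (h : ∀ k, ‖a (k + 1)‖ = ‖a k‖) (k : ℕ) : a k = 0 := by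
  have hc (m : ℕ) : ‖a m‖ = ‖a 0‖ := by
    induction m with
    | zero => rfl
    | succ m ih => rw [h, ih]
  have h1 := h0.norm
  simp only [hc, norm_zero] at h1
  have := tendsto_nhds_unique tendsto_const_nhds h1
  rw [← norm_eq_zero, hc, this]

/-- Solutions of the constant coefficient recurrence with characteristic roots `x`, `x⁻¹` on the
unit circle do not decay. -/
theorem eq_zero_of_recurrence {a : ℕ → ℂ} {x : ℂ} (hx : ‖x‖ = 1)
    (h0 : Filter.Tendsto a Filter.atTop (nhds 0))
    (h : ∀ k, a (k + 2) + a k = (x + x⁻¹) * a (k + 1)) (k : ℕ) : a k = 0 := by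
  have hx0 : x ≠ 0 := by rintro rfl; simp at hx
  have hb (k : ℕ) : a (k + 1) - x * a k = 0 := by
    refine eq_zero_of_tendsto_of_norm_succ (a := fun k => a (k + 1) - x * a k) ?_ (fun k => ?_) k
    · simpa using ((Filter.tendsto_add_atTop_iff_nat 1).mpr h0).sub (h0.const_mul x)
    · have : a (k + 1 + 1) - x * a (k + 1) = x⁻¹ * (a (k + 1) - x * a k) := by
        have := h k
        field_simp at this ⊢
        linear_combination this
      rw [this, norm_mul, norm_inv, hx, inv_one, one_mul]
  refine eq_zero_of_tendsto_of_norm_succ h0 (fun k => ?_) k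
  rw [sub_eq_zero.mp (hb k), norm_mul, hx, one_mul]

theorem tendsto_apply_comp (u : l2Z) {g : ℕ → ℤ} (hg : Function.Injective g) :
    Filter.Tendsto (fun k => u (g k)) Filter.atTop (nhds 0) := by
  have h := ((lp.memℓp u).summable (by norm_num)).tendsto_cofinite_zero
  have h2 := (h.comp hg.tendsto_cofinite)
  rw [Nat.cofinite_eq_atTop] at h2
  rw [tendsto_zero_iff_norm_tendsto_zero]
  have h3 := h2.rpow_const (p := 1 / 2) (Or.inr (by norm_num))
  simp only [Function.comp_def, ← Real.rpow_mul (norm_nonneg _)] at h3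
  norm_num at h3
  exact h3

/-- A finitely supported sequence cannot satisfy `(𝒞 - z) u = δ₀` with `z ≠ 0`: away from the
block `{0, 1}` the pair `(u n, (ℳ u) n)` is propagated by invertible matrices. -/
theorem sub_smul_ne_basisVec (α : ℤ → 𝔻) {z : ℂ} (hz : z ≠ 0) {u : l2Z} {a b : ℤ}
    (hu : SupportedIn a b u) :
    (extendedCMV α : l2Z →L[ℂ] l2Z) u - z • u ≠ basisVec 0 := by
  intro heq
  set v := blockCLM 1 α u with hv
  have hsv : SupportedIn (a - 1) (b + 1) v := hu.blockCLM 1 α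
  have hL (n : ℤ) : blockFun 0 α v n = z * u n + basisVec 0 n := by
    have := congrArg (fun w : l2Z => w n) heq
    rw [extendedCMV_apply] at this
    simp only [lp.coeFn_sub, lp.coeFn_smul, Pi.sub_apply, Pi.smul_apply, smul_eq_mul] at this
    rw [← this, hv]
    simp
  have hM (n : ℤ) : v n = blockFun 1 α u n := rfl
  have hstep (n : ℤ) (hn : n ≠ 0) :
      (u n = 0 ∧ v n = 0) ↔ (u (n + 1) = 0 ∧ v (n + 1) = 0) := by
    have hr := rho_ne_zero (α n)
    by_cases hne : Even n
    · have h0 : Even (n - 0) := by simpa using hne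
      have hn1 : n + 1 ≠ 0 := by rintro h; rw [show n = -1 by omega] at hne; simp at hne
      have e1 := hL n
      have e2 := hL (n + 1)
      rw [blockFun_of_even _ _ h0, basisVec_apply, if_neg hn] at e1
      rw [blockFun_succ_of_even _ _ h0, basisVec_apply, if_neg hn1] at e2
      constructor
      · rintro ⟨h1, h2⟩
        rw [h1, h2] at e1
        have h3 : v (n + 1) = 0 := by simpa [hr] using e1
        rw [h2, h3] at e2
        have h4 : u (n + 1) = 0 := by simpa [hz] using e2.symm
        exact ⟨h4, h3⟩
      · rintro ⟨h1, h2⟩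
        rw [h1, h2] at e2
        have h3 : v n = 0 := by simpa [hr] using e2
        rw [h2, h3] at e1
        have h4 : u n = 0 := by simpa [hz] using e1.symm
        exact ⟨h4, h3⟩
    · have h1 : Even (n - 1) := by rw [Int.even_sub_one]; exact hne
      have e1 := hM n
      have e2 := hM (n + 1)
      rw [blockFun_of_even _ _ h1] at e1
      rw [blockFun_succ_of_even _ _ h1] at e2
      constructor
      · rintro ⟨h1, h2⟩
        rw [h1, h2] at e1
        have h3 : u (n + 1) = 0 := by simpa [hr] using e1.symm
        rw [h1, h3] at e2
        exact ⟨h3, by simpa using e2⟩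
      · rintro ⟨h1, h2⟩
        rw [h1, h2] at e2
        have h3 : u n = 0 := by simpa [hr] using e2.symm
        rw [h1, h3] at e1
        exact ⟨h3, by simpa using e1⟩
  have hright (k : ℕ) : u 1 = 0 ∧ v 1 = 0 ↔ u (1 + k) = 0 ∧ v (1 + k) = 0 := by
    induction k with
    | zero => simp
    | succ k ih =>
      rw [ih, hstep _ (by omega)]
      push_cast
      rw [add_assoc]
  have hleft (k : ℕ) : u 0 = 0 ∧ v 0 = 0 ↔ u (-k) = 0 ∧ v (-k) = 0 := by
    induction k with
    | zero => simp
    | succ k ih =>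
      rw [ih, hstep (-(k + 1 : ℕ)) (by omega)]
      push_cast
      rw [show -((k : ℤ) + 1) + 1 = -k by ring]
  have h1 : v 1 = 0 := ((hright (b.natAbs + 1)).mpr
    ⟨hu _ (by omega), hsv _ (by omega)⟩).2
  have h0 : u 0 = 0 ∧ v 0 = 0 := (hleft (a.natAbs + 2)).mpr
    ⟨hu _ (by omega), hsv _ (by omega)⟩
  have := hL 0
  rw [blockFun_of_even _ _ (by simp), zero_add, h1, h0.1, h0.2, basisVec_apply] at this
  simp at this

theorem norm_translation_le (k : ℤ) : ‖translation k‖ ≤ 1 :=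
  LinearMap.mkContinuous_norm_le _ zero_le_one _

/-- Under the magic formula, `z` lies in the spectrum of `𝒞` exactly when `Δ z = x + x⁻¹` for some
`x` on the unit circle. If `𝒞 - z` were invertible for such a `z`, then `u = (𝒞 - z)⁻¹ δ₀` would
satisfy `(S^p + S^{-p} - Δ z) u = h(𝒞) δ₀` with a finitely supported right-hand side; being square
summable, `u` would be finitely supported itself. -/
theorem MagicFormula.mem_spectrum_iff {p : ℕ} {α₀ α : ℤ → 𝔻} (h : MagicFormula p α₀ α)
    (hp0 : 0 < p) (z : ℂˣ) : (z : ℂ) ∈ spectrum ℂ (extendedCMV α : l2Z →L[ℂ] l2Z) ↔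
      ∃ x : ℂ, ‖x‖ = 1 ∧ evalAt z (discriminant p α₀) = x + x⁻¹ := by
  constructor
  · intro hz
    have h1 := (mem_spectrum_evalAt_iff (extendedCMV α) (discriminant p α₀) _).mpr ⟨z, hz, rfl⟩
    have h2 : evalAt (extendedCMV α) (discriminant p α₀) =
        evalAt (shift ^ (p : ℤ)) (T 1 + T (-1)) := by
      rw [← smeval_eq_evalAt, h, map_add, evalAt_T, evalAt_T, zpow_one, zpow_neg_one, zpow_neg]
    rw [h2, mem_spectrum_evalAt_iff] at h1
    obtain ⟨x, hx, hxe⟩ := h1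
    have hx' : ((x⁻¹ : ℂˣ) : ℂ) ∈ spectrum ℂ (((shift ^ (p : ℤ))⁻¹ : (l2Z →L[ℂ] l2Z)ˣ) :
        l2Z →L[ℂ] l2Z) := by
      have := (mem_spectrum_evalAt_iff (shift ^ (p : ℤ)) (T (-1)) _).mpr ⟨x, hx, rfl⟩
      rwa [evalAt_T, evalAt_T, zpow_neg_one, zpow_neg_one] at this
    have n1 := (spectrum.norm_le_norm_of_mem hx)
    have n2 := (spectrum.norm_le_norm_of_mem hx')
    rw [coe_shift_zpow] at n1
    rw [← zpow_neg, coe_shift_zpow, Units.val_inv_eq_inv_val, norm_inv] at n2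
    refine ⟨x, le_antisymm (n1.trans (norm_translation_le _)) ?_, ?_⟩
    · exact (inv_le_one₀ (norm_pos_iff.mpr x.ne_zero)).mp (n2.trans (norm_translation_le _))
    · rw [← hxe, map_add, evalAt_T, evalAt_T]; simp
  · rintro ⟨x, hx, hxe⟩
    by_contra hz
    rw [spectrum.notMem_iff] at hz
    obtain ⟨G, hG⟩ := hz
    set u : l2Z := -((G⁻¹ : (l2Z →L[ℂ] l2Z)ˣ).val (basisVec 0)) with hu
    have hCu : (extendedCMV α : l2Z →L[ℂ] l2Z) u - (z : ℂ) • u = basisVec 0 := by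
      have h1 : G.val ((G⁻¹ : (l2Z →L[ℂ] l2Z)ˣ).val (basisVec 0)) = basisVec 0 := by
        rw [← mul_apply_eq_comp, ← Units.val_mul]; simp
      have h2 : G.val u = -basisVec 0 := by rw [hu, map_neg, h1]
      rw [hG] at h2
      simp only [sub_apply, Algebra.algebraMap_eq_smul_one, smul_apply, one_apply_eq_self] at h2
      rw [← neg_inj, ← h2]
      abel
    obtain ⟨f, hf⟩ := exists_sub_eval_eq_mul (discriminant p α₀) z
    obtain ⟨d, hd⟩ := exists_coeff_bound f
    set w := evalAt (extendedCMV α) f (basisVec 0) with hw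
    have hws : SupportedIn (0 - 2 * d) (0 + 2 * d) w := (supportedIn_basisVec 0).evalAt α hd
    have hrec (n : ℤ) : u (n - p) + u (n + p) - (x + x⁻¹) * u n = w n := by
      have := congrArg (fun g => evalAt (extendedCMV α) g u n) (hf.trans (mul_comm _ _))
      simp only [map_mul, map_sub, evalAt_C, evalAt_T, zpow_one, mul_apply_eq_comp, sub_apply,
        Algebra.algebraMap_eq_smul_one, smul_apply, one_apply_eq_self, hCu] at this
      rw [lp.coeFn_sub, Pi.sub_apply, (magicFormula_iff p α₀ α).mp h, hxe] at this
      exact this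
    have hsupp : SupportedIn (-2 * |d| - p) (2 * |d| + p) u := by
      have hpz : (0 : ℤ) < p := by exact_mod_cast hp0
      have hdd := le_abs_self d
      rintro n (hn | hn)
      · have hinj : Function.Injective (fun k : ℕ => n - k * p) := by
          intro k l hkl
          have : (k : ℤ) * p = l * p := by simpa using hkl
          exact_mod_cast mul_right_cancel₀ hpz.ne' this
        have := eq_zero_of_recurrence hx (tendsto_apply_comp u hinj) (fun k => ?_) 0
        · simpa using this
        · have h1 := hrec (n - (k + 1 : ℕ) * p)
          have hk : (0 : ℤ) ≤ k * p := by positivity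
          rw [hws _ (by left; push_cast; nlinarith)] at h1
          push_cast at h1 ⊢
          rw [show n - ((k : ℤ) + 1) * p - p = n - (k + 1 + 1) * p by ring,
            show n - ((k : ℤ) + 1) * p + p = n - k * p by ring] at h1
          linear_combination h1
      · have hinj : Function.Injective (fun k : ℕ => n + k * p) := by
          intro k l hkl
          have : (k : ℤ) * p = l * p := by simpa using hkl
          exact_mod_cast mul_right_cancel₀ hpz.ne' this
        have := eq_zero_of_recurrence hx (tendsto_apply_comp u hinj) (fun k => ?_) 0
        · simpa using this
        · have h1 := hrec (n + (k + 1 : ℕ) * p)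
          have hk : (0 : ℤ) ≤ k * p := by positivity
          rw [hws _ (by right; push_cast; nlinarith)] at h1
          push_cast at h1 ⊢
          rw [show n + ((k : ℤ) + 1) * p - p = n + k * p by ring,
            show n + ((k : ℤ) + 1) * p + p = n + (k + 1 + 1) * p by ring] at h1
          linear_combination h1
    exact sub_smul_ne_basisVec α z.ne_zero hsupp hCu

theorem MagicFormula.spectrum_eq {p : ℕ} {α₀ α β : ℤ → 𝔻} (hp0 : 0 < p) (h : MagicFormula p α₀ α)
    (h' : MagicFormula p α₀ β) : spectrum ℂ (extendedCMV α : l2Z →L[ℂ] l2Z) =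
      spectrum ℂ (extendedCMV β : l2Z →L[ℂ] l2Z) := by
  ext z
  by_cases hz : z = 0
  · subst hz
    exact iff_of_false (spectrum.zero_notMem ℂ (extendedCMV α).isUnit)
      (spectrum.zero_notMem ℂ (extendedCMV β).isUnit)
  · exact (h.mem_spectrum_iff hp0 (Units.mk0 z hz)).trans
      (h'.mem_spectrum_iff hp0 (Units.mk0 z hz)).symm

/-! ### Unitarity and the norm of the discriminant of an isospectral operator -/

theorem inner_basisVec_left (m : ℤ) (u : l2Z) : inner ℂ (basisVec m) u = u m := by
  rw [basisVec, lp.inner_single_left]; simp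

theorem inner_basisVec_right (m : ℤ) (u : l2Z) : inner ℂ u (basisVec m) = conj (u m) := by
  rw [← inner_conj_symm, inner_basisVec_left]

theorem ext_basisVec {X Y : l2Z →L[ℂ] l2Z} (h : ∀ m n, X (basisVec m) n = Y (basisVec m) n) :
    X = Y := by
  refine lp.ext_continuousLinearMap (by norm_num) fun m => ?_
  ext n
  exact h m n

theorem star_blockCLM (e : ℤ) (α : ℤ → 𝔻) :
    star (blockCLM e α) = blockCLM e (fun n => star (α n)) := by
  refine ext_basisVec fun m n => ?_
  rw [ContinuousLinearMap.star_eq_adjoint, ← inner_basisVec_left n,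
    ContinuousLinearMap.adjoint_inner_right, inner_basisVec_right, blockCLM_apply, blockCLM_apply]
  have hrho (a : 𝔻) : rho (star a) = rho a := by simp [rho]
  unfold blockFun
  simp only [basisVec_apply]
  by_cases h1 : Even (n - e)
  · by_cases h2 : Even (m - e)
    · have h3 : n + 1 ≠ m := by
        rintro rfl
        rw [show n + 1 - e = n - e + 1 by ring, Int.even_add_one] at h2; exact h2 h1
      have h4 : m + 1 ≠ n := by
        rintro rfl
        rw [show m + 1 - e = m - e + 1 by ring, Int.even_add_one] at h1; exact h1 h2
      by_cases h5 : n = m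
      · subst h5; simp [h1, Theta]
      · simp [h1, h2, h3, h4, h5, Ne.symm h5]
    · have h5 : n ≠ m := by rintro rfl; exact h2 h1
      by_cases h3 : n + 1 = m
      · subst h3; simp [h1, h2, Theta, hrho]
      · simp [h1, h2, h3, h5, Ne.symm h5, show m - 1 ≠ n by omega]
  · by_cases h2 : Even (m - e)
    · have h5 : n ≠ m := by rintro rfl; exact h1 h2
      by_cases h3 : m + 1 = n
      · subst h3; simp [h1, h2, Theta, hrho]
      · simp [h1, h2, h3, h5, Ne.symm h5, show n - 1 ≠ m by omega]
    · have h3 : n - 1 ≠ m := by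
        rintro rfl
        rw [show n - 1 - e = n - e - 1 by ring, Int.even_sub_one] at h2; exact h2 h1
      have h4 : m - 1 ≠ n := by
        rintro rfl
        rw [show m - 1 - e = m - e - 1 by ring, Int.even_sub_one] at h1; exact h1 h2
      by_cases h5 : n = m
      · subst h5; simp [h1, Theta]
      · simp [h1, h2, h3, h4, h5, Ne.symm h5]

theorem star_extendedCMV (α : ℤ → 𝔻) : star (extendedCMV α) = (extendedCMV α)⁻¹ := by
  ext1
  rw [Units.coe_star]
  change star (blockCLM 0 α * blockCLM 1 α) =
    blockCLM 1 (fun n => star (α n)) * blockCLM 0 (fun n => star (α n))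
  rw [star_mul, star_blockCLM, star_blockCLM]

theorem isStarNormal_evalAt (α : ℤ → 𝔻) (f : ℂ[T;T⁻¹]) :
    IsStarNormal (evalAt (extendedCMV α) f) := by
  have h (f : ℂ[T;T⁻¹]) : ∃ g, star (evalAt (extendedCMV α) f) = evalAt (extendedCMV α) g := by
    induction f using LaurentPolynomial.induction_on' with
    | add p q hp hq =>
      obtain ⟨p', hp⟩ := hp
      obtain ⟨q', hq⟩ := hq
      exact ⟨p' + q', by rw [map_add, star_add, hp, hq, map_add]⟩
    | C_mul_T n a =>
      -- `𝒞` is unitary, so adjoints of Laurent polynomials in `𝒞` are again such polynomials.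
      refine ⟨C (star a) * T (-n), ?_⟩
      rw [map_mul, map_mul, star_mul, evalAt_C, evalAt_C, evalAt_T, evalAt_T, ← Units.coe_star,
        star_zpow, star_extendedCMV, inv_zpow, ← zpow_neg, ← algebraMap_star_comm]
      exact (Algebra.commutes _ _).symm
  obtain ⟨g, hg⟩ := h f
  refine ⟨?_⟩
  rw [hg, commute_iff_eq, ← map_mul, ← map_mul, mul_comm]

/-- The discriminant is bounded by `2` on the spectrum of the periodic operator, so by normality
its value at any extended CMV matrix with the same spectrum has norm at most `2`. -/
theorem norm_evalAt_discriminant_le {p : ℕ} {α₀ α : ℤ → 𝔻} (h : MagicFormula p α₀ α₀) (hp0 : 0 < p)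
    (hs : spectrum ℂ (extendedCMV α : l2Z →L[ℂ] l2Z) =
      spectrum ℂ (extendedCMV α₀ : l2Z →L[ℂ] l2Z)) :
    ‖evalAt (extendedCMV α) (discriminant p α₀)‖ ≤ 2 := by
  have hn := isStarNormal_evalAt α (discriminant p α₀)
  have h1 := IsStarNormal.spectralRadius_eq_nnnorm (evalAt (extendedCMV α) (discriminant p α₀))
  have h2 : spectralRadius ℂ (evalAt (extendedCMV α) (discriminant p α₀)) ≤ (2 : NNReal) := by
    refine iSup₂_le fun w hw => ?_
    obtain ⟨z, hz, rfl⟩ := (mem_spectrum_evalAt_iff _ _ _).mp hw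
    rw [hs, h.mem_spectrum_iff hp0] at hz
    obtain ⟨x, hx, hxe⟩ := hz
    rw [hxe]
    have : ‖x + x⁻¹‖ ≤ 2 := (norm_add_le _ _).trans (by rw [norm_inv, hx]; norm_num)
    exact_mod_cast this
  rw [h1] at h2
  exact_mod_cast h2

/-! ### Extreme coefficients of the discriminant -/

theorem coeff_C_mul (c : ℂ) (f : ℂ[T;T⁻¹]) (k : ℤ) : (C c * f).coeff k = c * f.coeff k := by
  rw [← smul_eq_C_mul]; simp

theorem coeff_T_mul (n : ℤ) (f : ℂ[T;T⁻¹]) (k : ℤ) : (T n * f).coeff k = f.coeff (k - n) := by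
  rw [T, AddMonoidAlgebra.coeff_single_mul_apply, one_mul, neg_add_eq_sub]

theorem stepProd_succ_zero (α : ℤ → 𝔻) (n : ℕ) (j : Fin 2) (k : ℤ) :
    (stepProd α (n + 1) 0 j).coeff k = (rho (α n) : ℂ)⁻¹ *
      ((stepProd α n 0 j).coeff (k - 1) - conj (α n : ℂ) * (stepProd α n 1 j).coeff k) := by
  have h : stepProd α (n + 1) 0 j = C ((rho (α n) : ℂ)⁻¹) *
      (T 1 * stepProd α n 0 j - C (conj (α n : ℂ)) * stepProd α n 1 j) := by
    simp only [stepProd, stepMatrix, Matrix.mul_apply, Fin.sum_univ_two, Matrix.smul_apply,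
      smul_eq_mul, Matrix.of_apply, Matrix.cons_val', Matrix.cons_val_zero, Matrix.cons_val_one,
      Matrix.cons_val_fin_one]
    ring
  rw [h, coeff_C_mul, AddMonoidAlgebra.coeff_sub, Finsupp.sub_apply, coeff_T_mul, coeff_C_mul]

theorem stepProd_succ_one (α : ℤ → 𝔻) (n : ℕ) (j : Fin 2) (k : ℤ) :
    (stepProd α (n + 1) 1 j).coeff k = (rho (α n) : ℂ)⁻¹ *
      ((stepProd α n 1 j).coeff k - (α n : ℂ) * (stepProd α n 0 j).coeff (k - 1)) := by
  have h : stepProd α (n + 1) 1 j = C ((rho (α n) : ℂ)⁻¹) *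
      (stepProd α n 1 j - C (α n : ℂ) * (T 1 * stepProd α n 0 j)) := by
    simp only [stepProd, stepMatrix, Matrix.mul_apply, Fin.sum_univ_two, Matrix.smul_apply,
      smul_eq_mul, Matrix.of_apply, Matrix.cons_val', Matrix.cons_val_zero, Matrix.cons_val_one,
      Matrix.cons_val_fin_one]
    ring
  rw [h, coeff_C_mul, AddMonoidAlgebra.coeff_sub, Finsupp.sub_apply, coeff_C_mul, coeff_T_mul]

/-- The product of the numbers `ρ` over one period. -/
noncomputable def rhoProd (p : ℕ) (α : ℤ → 𝔻) : ℝ := ∏ i ∈ Finset.range p, rho (α i)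

theorem rhoProd_pos (p : ℕ) (α : ℤ → 𝔻) : 0 < rhoProd p α :=
  Finset.prod_pos fun _ _ => rho_pos _

/-- The entries of the step product are polynomials of degree at most `n + 1` without constant term
in the first column and of degree at most `n` in the second column. -/
theorem stepProd_coeff (α : ℤ → 𝔻) (n : ℕ) :
    (stepProd α (n + 1) 0 0).coeff (n + 1) = (rhoProd (n + 1) α : ℂ)⁻¹ ∧
    (stepProd α (n + 1) 1 1).coeff 0 = (rhoProd (n + 1) α : ℂ)⁻¹ ∧
    (∀ i : Fin 2, ∀ k : ℤ, k < 1 ∨ n + 1 < k → (stepProd α (n + 1) i 0).coeff k = 0) ∧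
    (∀ i : Fin 2, ∀ k : ℤ, k < 0 ∨ n < k → (stepProd α (n + 1) i 1).coeff k = 0) := by
  induction n with
  | zero =>
    have h1 (k : ℤ) : (1 : ℂ[T;T⁻¹]).coeff k = if 0 = k then 1 else 0 := by
      rw [← T_zero, T_apply]
    refine ⟨?_, ?_, fun i k hk => ?_, fun i k hk => ?_⟩
    · rw [stepProd_succ_zero]; simp [stepProd, h1, rhoProd]
    · rw [stepProd_succ_one]; simp [stepProd, h1, rhoProd]
    · have : (0 : ℤ) ≠ k - 1 := by push_cast at hk; omega
      fin_cases i
      · exact (stepProd_succ_zero α 0 0 k).trans (by simp [stepProd, h1, this])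
      · exact (stepProd_succ_one α 0 0 k).trans (by simp [stepProd, h1, this])
    · have : (0 : ℤ) ≠ k := by push_cast at hk; omega
      fin_cases i
      · exact (stepProd_succ_zero α 0 1 k).trans (by simp [stepProd, h1, this])
      · exact (stepProd_succ_one α 0 1 k).trans (by simp [stepProd, h1, this])
  | succ n ih =>
    obtain ⟨h00, h11, h0, h1⟩ := ih
    have hprod : (rhoProd (n + 1 + 1) α : ℂ)⁻¹ =
        (rho (α (n + 1 : ℕ)) : ℂ)⁻¹ * (rhoProd (n + 1) α : ℂ)⁻¹ := by
      rw [rhoProd, Finset.prod_range_succ, ← rhoProd, Complex.ofReal_mul, mul_inv, mul_comm]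
    push_cast
    refine ⟨?_, ?_, fun i k hk => ?_, fun i k hk => ?_⟩
    · rw [stepProd_succ_zero, add_sub_cancel_right, h00, h0 1 _ (by omega), hprod]; ring
    · rw [stepProd_succ_one, h11, h1 0 _ (by omega), hprod]; ring
    · fin_cases i
      · refine (stepProd_succ_zero α (n + 1) 0 k).trans ?_
        rw [h0 0 _ (by omega), h0 1 _ (by omega)]; ring
      · refine (stepProd_succ_one α (n + 1) 0 k).trans ?_
        rw [h0 0 _ (by omega), h0 1 _ (by omega)]; ring
    · fin_cases i
      · refine (stepProd_succ_zero α (n + 1) 1 k).trans ?_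
        rw [h1 0 _ (by omega), h1 1 _ (by omega)]; ring
      · refine (stepProd_succ_one α (n + 1) 1 k).trans ?_
        rw [h1 0 _ (by omega), h1 1 _ (by omega)]; ring

/-- The discriminant has the form `(∏ ρ)⁻¹ (z^{p/2} + z^{-p/2})` plus terms of lower order. -/
theorem discriminant_coeff {p : ℕ} (hp : Even p) (hp0 : 0 < p) (α : ℤ → 𝔻) {d : ℤ}
    (hd : 2 * d = p) :
    (discriminant p α).coeff d = (rhoProd p α : ℂ)⁻¹ ∧
    (discriminant p α).coeff (-d) = (rhoProd p α : ℂ)⁻¹ ∧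
    ∀ k, d < |k| → (discriminant p α).coeff k = 0 := by
  obtain ⟨n, rfl⟩ := Nat.exists_eq_succ_of_ne_zero hp0.ne'
  obtain ⟨h00, h11, h0, h1⟩ := stepProd_coeff α n
  have hpd : (((n + 1) / 2 : ℕ) : ℤ) = d := by
    obtain ⟨k, hk⟩ := hp
    omega
  have hk (k : ℤ) : (discriminant (n + 1) α).coeff k =
      (stepProd α (n + 1) 0 0).coeff (k + d) + (stepProd α (n + 1) 1 1).coeff (k + d) := by
    rw [discriminant, Matrix.trace_smul, Matrix.trace_fin_two, smul_eq_mul, coeff_T_mul,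
      AddMonoidAlgebra.coeff_add, Finsupp.add_apply, hpd, sub_neg_eq_add]
  push_cast at hd
  simp only [Nat.succ_eq_add_one]
  refine ⟨?_, ?_, fun k hkd => ?_⟩
  · rw [hk, show d + d = n + 1 by omega, h00, h1 1 _ (by omega), add_zero]
  · rw [hk, neg_add_cancel, h11, h0 0 _ (by omega), zero_add]
  · have : k + d < 0 ∨ n + 1 < k + d := by
      rcases lt_abs.mp hkd with h | h
      · right; omega
      · left; omega
    rw [hk, h0 0 _ (by omega), h1 1 _ (by omega), add_zero]

/-! ### A lower bound for the norm of a translation invariant operator -/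

theorem norm_translation_apply (k : ℤ) (u : l2Z) : ‖translation k u‖ = ‖u‖ := by
  have h (m : ℤ) (v : l2Z) : ‖translation m v‖ ≤ ‖v‖ := by
    simpa using (translation m).le_of_opNorm_le (norm_translation_le m) v
  refine le_antisymm (h k u) ?_
  have h2 := h (-k) (translation k u)
  have h3 : translation (-k) (translation k u) = u := by ext n; simp
  rwa [h3] at h2

theorem inner_eq_of_supportedIn {a b m : ℤ} {u v : l2Z} (hu : SupportedIn a m u)
    (hv : SupportedIn m b v) : inner ℂ u v = v m * conj (u m) := by
  rw [lp.inner_eq_tsum, tsum_eq_single m]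
  · rfl
  · intro n hn
    rcases lt_or_gt_of_ne hn with h | h
    · rw [hv n (Or.inl h)]; simp
    · rw [hu n (Or.inr h)]; simp

/-- The norm of a sum of translates of `y` by the multiples of `2p`, where `y` lives on
`[j - p, j + p]` and neighbouring translates overlap only in their end points. -/
theorem norm_sum_translation_sq {p : ℕ} (hp0 : 0 < p) {j : ℤ} {y : l2Z} {r : ℝ}
    (hy : SupportedIn (j - p) (j + p) y) (h1 : y (j + p) = r) (h2 : y (j - p) = r) (N : ℕ) :
    SupportedIn (j - p) (j + p + 2 * N * p)
        (∑ k ∈ Finset.range (N + 1), translation (2 * k * p) y) ∧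
      (∑ k ∈ Finset.range (N + 1), translation (2 * k * p) y : l2Z) (j + p + 2 * N * p) = r ∧
      ‖∑ k ∈ Finset.range (N + 1), translation (2 * k * p) y‖ ^ 2 =
        (N + 1) * ‖y‖ ^ 2 + 2 * N * r ^ 2 := by
  have hpz : (0 : ℤ) < p := by exact_mod_cast hp0
  induction N with
  | zero =>
    have h0 : translation 0 y = y := by ext n; simp
    simp [h0, hy, h1]
  | succ N ih =>
    obtain ⟨ih1, ih2, ih3⟩ := ih
    have hN : (0 : ℤ) ≤ N * p := by positivity
    set Y : l2Z := ∑ k ∈ Finset.range (N + 1), translation (2 * k * p) y with hY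
    have hsum : (∑ k ∈ Finset.range (N + 1 + 1), translation (2 * k * p) y : l2Z) =
        Y + translation (2 * (N + 1 : ℕ) * p) y := by rw [Finset.sum_range_succ]
    have hz : SupportedIn (j + p + 2 * N * p) (j + p + 2 * (N + 1 : ℕ) * p)
        (translation (2 * (N + 1 : ℕ) * p) y) := by
      intro n hn
      rw [translation_apply]
      apply hy
      push_cast at hn ⊢
      rcases hn with h | h
      · left; linarith
      · right; linarith
    rw [hsum]
    refine ⟨fun n hn => ?_, ?_, ?_⟩
    · rw [lp.coeFn_add, Pi.add_apply]
      push_cast at hn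
      rw [ih1 n (hn.imp id fun h => by linarith), hz n (hn.imp (fun h => by linarith)
        fun h => by push_cast; linarith), add_zero]
    · rw [lp.coeFn_add, Pi.add_apply, translation_apply, add_sub_cancel_right, h1]
      rw [ih1 _ (by right; push_cast; linarith), zero_add]
    · rw [norm_add_sq (𝕜 := ℂ), inner_eq_of_supportedIn ih1 hz, ih2, ih3, norm_translation_apply,
        translation_apply, show j + p + 2 * (N : ℤ) * p - 2 * (N + 1 : ℕ) * p = j - p by
          push_cast; ring, h2, Complex.conj_ofReal, ← Complex.ofReal_mul, RCLike.re_to_complex,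
        Complex.ofReal_re]
      push_cast
      ring

/-- A vector `y` supported in `[j - p, j + p]` with end values `r` whose translates by multiples
of `2p` have sums bounded like `2 √N` satisfies `‖y‖² + 2 r² ≤ 4`. -/
theorem norm_sq_add_le {p : ℕ} (hp0 : 0 < p) {j : ℤ} {y : l2Z} {r : ℝ}
    (hy : SupportedIn (j - p) (j + p) y) (h1 : y (j + p) = r) (h2 : y (j - p) = r)
    (h : ∀ N : ℕ, ‖∑ k ∈ Finset.range (N + 1), translation (2 * k * p) y‖ ^ 2 ≤ 4 * (N + 1)) :
    ‖y‖ ^ 2 + 2 * r ^ 2 ≤ 4 := by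
  by_contra hlt
  push Not at hlt
  obtain ⟨N, hN⟩ := exists_nat_gt (2 * r ^ 2 / (‖y‖ ^ 2 + 2 * r ^ 2 - 4))
  rw [div_lt_iff₀ (by linarith)] at hN
  have := h N
  rw [(norm_sum_translation_sq hp0 hy h1 h2 N).2.2] at this
  nlinarith

theorem norm_sum_basisVec_sq {p : ℕ} (hp0 : 0 < p) (j : ℤ) (N : ℕ) :
    ‖∑ k ∈ Finset.range N, basisVec (j + 2 * k * p)‖ ^ 2 = N := by
  induction N with
  | zero => simp
  | succ N ih =>
    have hpz : (0 : ℤ) < p := by exact_mod_cast hp0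
    have h0 : (∑ k ∈ Finset.range N, basisVec (j + 2 * k * p) : l2Z) (j + 2 * N * p) = 0 := by
      rw [lp.coeFn_sum, Finset.sum_apply]
      refine Finset.sum_eq_zero fun k hk => ?_
      have hk' : (k : ℤ) < N := by exact_mod_cast Finset.mem_range.mp hk
      rw [basisVec_apply, if_neg]
      intro h
      nlinarith
    have h1 : ‖basisVec (j + 2 * N * p)‖ = 1 := by
      rw [basisVec, lp.norm_single (by norm_num), norm_one]
    rw [Finset.sum_range_succ, norm_add_sq (𝕜 := ℂ), inner_basisVec_right, h0, ih, h1]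
    simp

theorem commute_translation {α : ℤ → 𝔻} {q : ℤ} (hq : Even q) (hα : Function.Periodic α q)
    (f : ℂ[T;T⁻¹]) (u : l2Z) : evalAt (extendedCMV α) f (translation q u) =
      translation q (evalAt (extendedCMV α) f u) := by
  have hb (e : ℤ) (v : l2Z) : blockCLM e α (translation q v) = translation q (blockCLM e α v) := by
    ext n
    rw [translation_apply, blockCLM_apply, blockCLM_apply, blockFun, blockFun,
      if_congr (show Even (n - q - e) ↔ Even (n - e) by
        rw [show n - q - e = n - e - q by ring, Int.even_sub]; tauto) rfl rfl,
      hα.sub_eq, show n - q - 1 = n - 1 - q by ring, hα.sub_eq,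
      show n - q + 1 = n + 1 - q by ring]
    rfl
  have hc : Commute (translation q) (extendedCMV α : l2Z →L[ℂ] l2Z) := by
    ext1 v
    change translation q (blockCLM 0 α (blockCLM 1 α v)) =
      blockCLM 0 α (blockCLM 1 α (translation q v))
    rw [hb, hb]
  have hf : Commute (translation q) (evalAt (extendedCMV α) f) := by
    induction f using LaurentPolynomial.induction_on' with
    | add p q hp hq => rw [map_add]; exact hp.add_right hq
    | C_mul_T n a =>
      rw [map_mul, evalAt_C, evalAt_T]
      exact Commute.mul_right (Algebra.commutes a _).symm (hc.units_zpow_right n)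
  exact (congrArg (fun X : l2Z →L[ℂ] l2Z => X u) hf.eq).symm

theorem translation_basisVec (q m : ℤ) : translation q (basisVec m) = basisVec (m + q) := by
  ext n
  rw [translation_apply, basisVec_apply, basisVec_apply]
  exact if_congr (by omega) rfl rfl

/-! ### Isospectral periodic sequences -/

section Isospectral

variable {p : ℕ} {α₀ α : ℤ → 𝔻}

/-- The columns of `Δ₀(𝒞)` for periodic `α`: the extreme entries are governed by the ratio of the
leading coefficients of the two discriminants. -/
theorem discriminant_column (hp : Even p) (hp0 : 0 < p) (α₀ : ℤ → 𝔻)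
    (hα : Function.Periodic α (p : ℤ)) (j : ℤ) :
    SupportedIn (j - p) (j + p) (evalAt (extendedCMV α) (discriminant p α₀) (basisVec j)) ∧
    evalAt (extendedCMV α) (discriminant p α₀) (basisVec j) (j + p) =
      (rhoProd p α / rhoProd p α₀ : ℝ) ∧
    evalAt (extendedCMV α) (discriminant p α₀) (basisVec j) (j - p) =
      (rhoProd p α / rhoProd p α₀ : ℝ) := by
  obtain ⟨q, hq⟩ := hp.two_dvd
  have hd : 2 * (q : ℤ) = p := by rw [hq]; push_cast; ring
  obtain ⟨h1, h2, h3⟩ := discriminant_coeff hp hp0 α₀ hd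
  obtain ⟨g1, g2, g3⟩ := discriminant_coeff hp hp0 α hd
  set r : ℝ := rhoProd p α / rhoProd p α₀ with hr
  set f := discriminant p α₀ - C (r : ℂ) * discriminant p α with hf
  have hne : (rhoProd p α : ℂ) ≠ 0 := by exact_mod_cast (rhoProd_pos p α).ne'
  have hne0 : (rhoProd p α₀ : ℂ) ≠ 0 := by exact_mod_cast (rhoProd_pos p α₀).ne'
  have hfk (k : ℤ) (hk : (q : ℤ) - 1 < |k|) : f.coeff k = 0 := by
    rw [hf, AddMonoidAlgebra.coeff_sub, Finsupp.sub_apply, coeff_C_mul]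
    have hrr : (rhoProd p α₀ : ℂ)⁻¹ - r * (rhoProd p α : ℂ)⁻¹ = 0 := by
      rw [hr]; push_cast; field_simp; simp
    by_cases hk' : (q : ℤ) < |k|
    · rw [h3 k hk', g3 k hk']; simp
    · rcases abs_eq (show (0 : ℤ) ≤ q by omega) |>.mp (show |k| = q by omega) with rfl | rfl
      · rw [h1, g1, hrr]
      · rw [h2, g2, hrr]
  have hsupp := (supportedIn_basisVec j).evalAt α hfk
  have hval (n : ℤ) : evalAt (extendedCMV α) (discriminant p α₀) (basisVec j) n =
      r * (basisVec j (n - p) + basisVec j (n + p)) +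
        evalAt (extendedCMV α) f (basisVec j) n := by
    have : discriminant p α₀ = C (r : ℂ) * discriminant p α + f := by rw [hf]; ring
    rw [this, map_add, map_mul, evalAt_C, add_apply, lp.coeFn_add, Pi.add_apply,
      mul_apply_eq_comp, Algebra.algebraMap_eq_smul_one, smul_apply, one_apply_eq_self,
      lp.coeFn_smul, Pi.smul_apply,
      (magicFormula_iff p α α).mp (magicFormula_self hp hp0 hα), smul_eq_mul]
  refine ⟨fun n hn => ?_, ?_, ?_⟩
  · rw [hval, hsupp n (by omega), basisVec_apply, basisVec_apply, if_neg (by omega),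
      if_neg (by omega)]
    simp
  · rw [hval, hsupp _ (by omega), basisVec_apply, basisVec_apply, if_pos (by omega),
      if_neg (by omega)]
    simp
  · rw [hval, hsupp _ (by omega), basisVec_apply, basisVec_apply, if_neg (by omega),
      if_pos (by omega)]
    simp

/-- The bound of `norm_sq_add_le` for the columns of `Δ₀(𝒞)`, which are mapped to each other by
translations because `𝒞` commutes with translations by multiples of the period. -/
theorem norm_column_sq_add_le (hp : Even p) (hp0 : 0 < p)
    (hα₀ : Function.Periodic α₀ (p : ℤ)) (hα : Function.Periodic α (p : ℤ))
    (hs : spectrum ℂ (extendedCMV α : l2Z →L[ℂ] l2Z) =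
      spectrum ℂ (extendedCMV α₀ : l2Z →L[ℂ] l2Z)) (j : ℤ) :
    ‖evalAt (extendedCMV α) (discriminant p α₀) (basisVec j)‖ ^ 2 +
      2 * (rhoProd p α / rhoProd p α₀) ^ 2 ≤ 4 := by
  obtain ⟨h1, h2, h3⟩ := discriminant_column hp hp0 α₀ hα j
  refine norm_sq_add_le hp0 h1 h2 h3 fun N => ?_
  have hpe : Even (p : ℤ) := by exact_mod_cast hp
  have hsum : ∑ k ∈ Finset.range (N + 1), translation (2 * k * p)
      (evalAt (extendedCMV α) (discriminant p α₀) (basisVec j)) =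
      evalAt (extendedCMV α) (discriminant p α₀)
        (∑ k ∈ Finset.range (N + 1), basisVec (j + 2 * k * p)) := by
    rw [map_sum]
    refine Finset.sum_congr rfl fun k _ => ?_
    rw [← translation_basisVec, commute_translation (hpe.mul_left _)]
    simpa using hα.int_mul (2 * k)
  rw [hsum]
  have hn := (evalAt (extendedCMV α) (discriminant p α₀)).le_of_opNorm_le
    (norm_evalAt_discriminant_le (magicFormula_self hp hp0 hα₀) hp0 hs)
    (∑ k ∈ Finset.range (N + 1), basisVec (j + 2 * k * p))
  have hsq := norm_sum_basisVec_sq hp0 j (N + 1)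
  push_cast at hsq
  calc _ ≤ (2 * ‖∑ k ∈ Finset.range (N + 1), basisVec (j + 2 * k * p)‖) ^ 2 := by gcongr
    _ = 4 * (N + 1) := by rw [mul_pow, hsq]; norm_num

theorem sum_norm_sq_le (u : l2Z) (s : Finset ℤ) : ∑ n ∈ s, ‖u n‖ ^ 2 ≤ ‖u‖ ^ 2 := by
  have := lp.sum_rpow_le_norm_rpow (p := 2) (by norm_num) u s
  simpa using this

theorem rhoProd_le_of_spectrum_eq (hp : Even p) (hp0 : 0 < p)
    (hα₀ : Function.Periodic α₀ (p : ℤ)) (hα : Function.Periodic α (p : ℤ))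
    (hs : spectrum ℂ (extendedCMV α : l2Z →L[ℂ] l2Z) =
      spectrum ℂ (extendedCMV α₀ : l2Z →L[ℂ] l2Z)) : rhoProd p α ≤ rhoProd p α₀ := by
  obtain ⟨-, h2, h3⟩ := discriminant_column hp hp0 α₀ hα 0
  have h4 := norm_column_sq_add_le hp hp0 hα₀ hα hs 0
  have h5 := sum_norm_sq_le (evalAt (extendedCMV α) (discriminant p α₀) (basisVec 0))
    {0 + (p : ℤ), 0 - (p : ℤ)}
  rw [Finset.sum_pair (by omega), h2, h3, Complex.norm_real, Real.norm_eq_abs, sq_abs] at h5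
  have hpos := div_pos (rhoProd_pos p α) (rhoProd_pos p α₀)
  have : rhoProd p α / rhoProd p α₀ ≤ 1 := by nlinarith
  exact (div_le_one (rhoProd_pos p α₀)).mp this

/-- Periodic sequences with the spectrum of `𝒞₀` satisfy the magic formula: the leading
coefficients of the discriminants agree, and then the norm bound leaves no room for entries of
`Δ₀(𝒞)` other than those of `S^p + S^{-p}`. -/
theorem magicFormula_of_spectrum_eq (hp : Even p) (hp0 : 0 < p)
    (hα₀ : Function.Periodic α₀ (p : ℤ)) (hα : Function.Periodic α (p : ℤ))
    (hs : spectrum ℂ (extendedCMV α : l2Z →L[ℂ] l2Z) =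
      spectrum ℂ (extendedCMV α₀ : l2Z →L[ℂ] l2Z)) : MagicFormula p α₀ α := by
  have hr : rhoProd p α / rhoProd p α₀ = 1 := by
    rw [le_antisymm (rhoProd_le_of_spectrum_eq hp hp0 hα₀ hα hs)
      (rhoProd_le_of_spectrum_eq hp hp0 hα hα₀ hs.symm), div_self (rhoProd_pos p α₀).ne']
  rw [MagicFormula, smeval_eq_evalAt, coe_shift_zpow, coe_shift_zpow]
  refine ext_basisVec fun j n => ?_
  obtain ⟨-, h2, h3⟩ := discriminant_column hp hp0 α₀ hα j
  have h4 := norm_column_sq_add_le hp hp0 hα₀ hα hs j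
  rw [hr] at h2 h3 h4
  rw [add_apply, translation_basisVec, translation_basisVec, lp.coeFn_add, Pi.add_apply,
    basisVec_apply, basisVec_apply]
  by_cases hn1 : n = j + p
  · rw [if_pos hn1, if_neg (by omega), hn1, h2]; simp
  by_cases hn2 : n = j + -p
  · rw [if_neg hn1, if_pos hn2, hn2, ← sub_eq_add_neg, h3]; simp
  · rw [if_neg hn1, if_neg hn2, add_zero]
    have h5 := sum_norm_sq_le (evalAt (extendedCMV α) (discriminant p α₀) (basisVec j))
      {n, j + (p : ℤ), j - p}
    rw [Finset.sum_insert (by simp; omega), Finset.sum_pair (by omega), h2, h3] at h5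
    simp only [Complex.ofReal_one, norm_one] at h5
    have h6 : ‖evalAt (extendedCMV α) (discriminant p α₀) (basisVec j) n‖ ^ 2 ≤ 0 := by linarith
    simpa using le_antisymm h6 (sq_nonneg _)

end Isospectral

end CMV

theorem theorem3p1 (p : ℕ) (hp : Even p) (hp0 : 0 < p)
    (α₀ : ℤ → 𝔻) (hα₀ : Function.Periodic α₀ (p : ℤ)) (α : ℤ → 𝔻) :
    (CMV.MagicFormula p α₀ α ↔ α ∈ CMV.isospectralTorus p α₀) ∧
      (CMV.MagicFormula p α₀ α → Function.Periodic α (p : ℤ)) := by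
  refine ⟨⟨fun h => ⟨h.periodic hp hp0, ?_⟩, fun h => ?_⟩, fun h => h.periodic hp hp0⟩
  · exact h.spectrum_eq hp0 (CMV.magicFormula_self hp hp0 hα₀)
  · exact CMV.magicFormula_of_spectrum_eq hp hp0 hα₀ h.1 h.2
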